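/- **Conventions.** A quantum polynomial-time (QPT) algorithm is a family of quantum circuits $\{C_x\}_{x\in\{0,1\}^*}$ (ancillas in state $|0\rangle$, gates from a fixed finite universal set, discarding of wires at the end) whose descriptions are computed from $x$ in deterministic polynomial time; it induces for each $x$ a quantum channel. $\mathsf{BQP}$ is the class of languages $L\subseteq\{0,1\}^*$ for which some QPT algorithm accepts every $x\in L$ with probability at least $2/3$ and every $x\notin L$ with probability at most $1/3$. **Protocols.** In a two-message quantum protocol $\Pi=\langle P,V\rangle$ with common input $x$, the QPT verifier $V$ sends a quantum register to the prover and keeps a private register; the prover applies a quantum channel to the received register and returns the result (of a length fixed by $\Pi$ and $x$); $V$ then applies a circuit to the answer and its private register and outputs one bit, accepting if it is $1$. The honest prover $P$ is computationally unbounded: for each $x$ it may apply an arbitrary channel. Let $L$ be a language. * $\Pi$ is $\delta$-correct for $L$ if $V$ accepts with probability at least $\delta$ when interacting with $P$ on any $x\in L$. * $\Pi$ is computationally $\varepsilon$-sound for $L$ if for every QPT prover $\tilde P$ and every $x\notin L$, $V$ accepts $x$ when interacting with $\tilde P$ with probability at most $\varepsilon$. * $\Pi$ is computationally (auxiliary-input)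 quantum zero-knowledge for $L$ if for every QPT verifier $V^*$, which receives $x$ and an auxiliary quantum register of polynomial size and outputs a quantum register, there is a QPT simulator $S_{V^*}$ such that the channels $\Psi_x=(P\leftrightharpoons V^*(x,\cdot))$ and $\Phi_x=S_{V^*}(x,\cdot)$ on the auxiliary register are computationally indistinguishable for $x\in L$: for every polynomial $q$ there is a negligible function $\mu$ such that for all $x\in L$, all $k\le q(|x|)$, all circuits $D$ of size at most $q(|x|)$ with a one-bit output, and all states $\sigma$ of the auxiliary register together with $k$ further qubits, $$\bigl|\Pr[D((\Psi_x\otimes \mathrm{id})(\sigma))=1]-\Pr[D((\Phi_x\otimes \mathrm{id})(\sigma))=1]\bigr|\le\mu(|x|).$$ **Theorem.** Let $L$ be a language and let $\Pi$ be a two-message quantum proof system for $L$ that is $\tfrac23$-correct. If $\Pi$ is computationally $\varepsilon$-sound for some constant $\varepsilon<\tfrac13$ and computationally quantum zero-knowledge, then $L\in\mathsf{BQP}$. -/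

import Mathlib

open scoped ComplexOrder

/-! ### Deterministic polynomial time -/

/-- Programs of a multi-stack machine. The stacks are indexed by `ℕ` (each program mentions only
finitely many of them), and each stack holds bits. -/
inductive StackProg : Type where
  /-- Do nothing. -/
  | skip : StackProg
  /-- Push the bit `b` on stack `r`. -/
  | push (b : Bool) (r : ℕ) : StackProg
  /-- Remove the top bit of stack `r`, if there is one. -/
  | pop (r : ℕ) : StackProg
  /-- Run the first program, then the second one. -/
  | seq (a b : StackProg) : StackProg
  /-- Branch on stack `r`: it is empty, its top bit is `false`, its top bit is `true`. -/
  | branch (r : ℕ) (onEmpty onFalse onTrue : StackProg) : StackProg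
  /-- Repeat the body as long as stack `r` is nonempty. -/
  | loop (r : ℕ) (body : StackProg) : StackProg

/-- The contents of all stacks; the head of a list is the top of the stack. -/
abbrev Store : Type := ℕ → List Bool

/-- `Runs c s t s'`: started on the stacks `s`, the program `c` halts after exactly `t` steps with
the stacks `s'`. Every elementary operation and every test of a stack is one step. -/
inductive StackProg.Runs : StackProg → Store → ℕ → Store → Prop where
  | skip (s : Store) : Runs .skip s 1 s
  | push (b : Bool) (r : ℕ) (s : Store) :
      Runs (.push b r) s 1 (Function.update s r (b :: s r))
  | pop (r : ℕ) (s : Store) : Runs (.pop r) s 1 (Function.update s r (s r).tail)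
  | seq {a b : StackProg} {s s' s'' : Store} {t t' : ℕ} :
      Runs a s t s' → Runs b s' t' s'' → Runs (.seq a b) s (t + t') s''
  | branch_empty {r : ℕ} {a b c : StackProg} {s s' : Store} {t : ℕ} :
      s r = [] → Runs a s t s' → Runs (.branch r a b c) s (t + 1) s'
  | branch_false {r : ℕ} {a b c : StackProg} {s s' : Store} {t : ℕ} :
      (s r).head? = some false → Runs b s t s' → Runs (.branch r a b c) s (t + 1) s'
  | branch_true {r : ℕ} {a b c : StackProg} {s s' : Store} {t : ℕ} :
      (s r).head? = some true → Runs c s t s' → Runs (.branch r a b c) s (t + 1) s'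
  | loop_stop {r : ℕ} {a : StackProg} {s : Store} : s r = [] → Runs (.loop r a) s 1 s
  | loop_step {r : ℕ} {a : StackProg} {s s' s'' : Store} {t t' : ℕ} :
      s r ≠ [] → Runs a s t s' → Runs (.loop r a) s' t' s'' →
        Runs (.loop r a) s (t + t' + 1) s''

/-- The input is on stack `0`; all other stacks are empty. -/
def inputStore (x : List Bool) : Store := fun r => if r = 0 then x else []

/-- `f` is computable in deterministic polynomial time: some program, started with `x` on stack
`0`, halts within polynomially many steps with `f x` on stack `1`. -/
def PolyTime (f : List Bool → List Bool) : Prop :=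
  ∃ (c : StackProg) (q : Polynomial ℕ), ∀ x : List Bool, ∃ (t : ℕ) (s : Store),
    c.Runs (inputStore x) t s ∧ t ≤ q.eval x.length ∧ s 1 = f x

/-- The natural number `f x`, written in unary, is computable in polynomial time. In particular
`f x` is bounded by a polynomial in `|x|`. -/
def PolyTimeLength (f : List Bool → ℕ) : Prop :=
  PolyTime fun x => List.replicate (f x) true

/-! ### Registers of qubits and superoperators -/

/-- Labels of the computational basis of `n` qubits. -/
abbrev Bits (n : ℕ) : Type := Fin n → Bool

/-- Operators on the space of `n` qubits. -/
abbrev Op (n : ℕ) : Type := Matrix (Bits n) (Bits n) ℂ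

/-- Operators on a pair of registers of `n` and `k` qubits. -/
abbrev Op₂ (n k : ℕ) : Type := Matrix (Bits n × Bits k) (Bits n × Bits k) ℂ

/-- View an `n + k` qubit register as a pair of registers, the first `n` qubits coming first. -/
def splitOp {n k : ℕ} (ρ : Op (n + k)) : Op₂ n k :=
  Matrix.of fun a b => ρ (Fin.append a.1 a.2) (Fin.append b.1 b.2)

/-- View a pair of registers as one register of `n + k` qubits. -/
def joinOp {n k : ℕ} (ρ : Op₂ n k) : Op (n + k) :=
  Matrix.of fun y z => ρ (fun i => y (Fin.castAdd k i), fun i => y (Fin.natAdd n i))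
    (fun i => z (Fin.castAdd k i), fun i => z (Fin.natAdd n i))

/-- The superoperator `Φ ⊗ id`, with the identity acting on a register of `k` qubits. -/
def tensorId {n m : ℕ} (Φ : Op n → Op m) (k : ℕ) (ρ : Op₂ n k) : Op₂ m k :=
  Matrix.of fun a b => Φ (Matrix.of fun y z => ρ (y, a.2) (z, b.2)) a.1 b.1

/-- Density operators. -/
def IsState {ι : Type} [Fintype ι] (ρ : Matrix ι ι ℂ) : Prop :=
  ρ.PosSemidef ∧ ρ.trace = 1

/-- Quantum channels: linear, completely positive, trace preserving maps. -/
structure IsChannel {n m : ℕ} (Φ : Op n → Op m) : Prop where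
  linear : IsLinearMap ℂ Φ
  completelyPositive : ∀ (k : ℕ) (ρ : Op₂ n k), ρ.PosSemidef → (tensorId Φ k ρ).PosSemidef
  tracePreserving : ∀ ρ : Op n, (Φ ρ).trace = ρ.trace

/-- The probability that measuring a qubit in the computational basis gives `1`. -/
def probOne (ρ : Op 1) : ℝ := (ρ (fun _ => true) (fun _ => true)).re

/-! ### Quantum circuits -/

/-- The gates: Hadamard, the phase gate `diag(1, i)`, NOT, controlled NOT and Toffoli (a universal
set). The wires are named by natural numbers; the target is the last argument. -/
inductive Gate : Type where
  | had (i : ℕ) : Gate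
  | phase (i : ℕ) : Gate
  | not (i : ℕ) : Gate
  | cnot (c i : ℕ) : Gate
  | toffoli (c d i : ℕ) : Gate

/-- The bit on wire `i` (and `false` if there is no such wire). -/
def wire {w : ℕ} (y : Bits w) (i : ℕ) : Bool := if h : i < w then y ⟨i, h⟩ else false

/-- Add the bit `b` modulo 2 to the bit on wire `i`. -/
def toggle {w : ℕ} (b : Bool) (i : ℕ) (y : Bits w) : Bits w :=
  fun j => if (j : ℕ) = i then xor (y j) b else y j

/-- The operator of a gate on `w` wires, as a matrix in the computational basis. -/
noncomputable def Gate.op (w : ℕ) : Gate → Op w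
  | .had i => Matrix.of fun y z =>
      if ∀ j : Fin w, (j : ℕ) ≠ i → y j = z j then
        (if wire y i && wire z i then -1 else 1 : ℂ) / (Real.sqrt 2 : ℂ) else 0
  | .phase i => Matrix.diagonal fun y => if wire y i then Complex.I else 1
  | .not i => Matrix.of fun y z => if y = toggle true i z then 1 else 0
  | .cnot c i => Matrix.of fun y z => if y = toggle (wire z c) i z then 1 else 0
  | .toffoli c d i => Matrix.of fun y z => if y = toggle (wire z c && wire z d) i z then 1 else 0

/-- The gate acts on distinct wires among the first `w` ones. -/
def Gate.Valid (w : ℕ) : Gate → Prop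
  | .had i => i < w
  | .phase i => i < w
  | .not i => i < w
  | .cnot c i => c < w ∧ i < w ∧ c ≠ i
  | .toffoli c d i => c < w ∧ d < w ∧ i < w ∧ c ≠ d ∧ c ≠ i ∧ d ≠ i

/-- A quantum circuit: a number of wires and a list of gates, to be applied from left to right. -/
structure QCircuit : Type where
  width : ℕ
  gates : List Gate

/-- The unitary operator of a circuit. -/
noncomputable def QCircuit.unitary (C : QCircuit) : Op C.width :=
  C.gates.foldl (fun U g => g.op C.width * U) 1

/-- The circuit can be used with `n` input qubits and `m` output qubits. -/
def QCircuit.Valid (C : QCircuit) (n m : ℕ) : Prop :=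
  n ≤ C.width ∧ m ≤ C.width ∧ ∀ g ∈ C.gates, g.Valid C.width

/-- Place an `n` qubit operator on the first `n` of `w` wires; the remaining wires are ancillas
in the state `|0⟩`. (Meant for `n ≤ w`.) -/
noncomputable def addAncillas {n : ℕ} (w : ℕ) (ρ : Op n) : Op w :=
  Matrix.of fun y z => if ∀ j : Fin w, n ≤ (j : ℕ) → y j = false ∧ z j = false then
    ρ (fun i => wire y i) (fun i => wire z i) else 0

/-- Concatenation of bit strings, as a string of length `w`. (Meant for `m ≤ w`.) -/
def glue {m w : ℕ} (a : Bits m) (b : Bits (w - m)) : Bits w :=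
  fun j => if h : (j : ℕ) < m then a ⟨j, h⟩ else b ⟨j - m, by omega⟩

/-- Keep the first `m` of `w` wires and trace out the other ones. (Meant for `m ≤ w`.) -/
noncomputable def keepFirst {w : ℕ} (m : ℕ) (ρ : Op w) : Op m :=
  Matrix.of fun a b => ∑ e : Bits (w - m), ρ (glue a e) (glue b e)

/-- The superoperator from `n` to `m` qubits of a circuit: add ancillas, apply the unitary, and
discard all but the first `m` wires. It is a quantum channel if the circuit is valid. -/
noncomputable def QCircuit.channel (C : QCircuit) (n m : ℕ) (ρ : Op n) : Op m :=
  keepFirst m (C.unitary * addAncillas C.width ρ * C.unitary.conjTranspose)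

/-- The size of a circuit: the number of wires plus the number of gates. -/
def QCircuit.size (C : QCircuit) : ℕ := C.width + C.gates.length

/-- Self-delimiting unary code of a natural number. -/
def encodeNat (n : ℕ) : List Bool := List.replicate n true ++ [false]

/-- The description of a gate: the name of the gate followed by its wires. -/
def Gate.encode : Gate → List Bool
  | .had i => encodeNat 0 ++ encodeNat i
  | .phase i => encodeNat 1 ++ encodeNat i
  | .not i => encodeNat 2 ++ encodeNat i
  | .cnot c i => encodeNat 3 ++ encodeNat c ++ encodeNat i
  | .toffoli c d i => encodeNat 4 ++ encodeNat c ++ encodeNat d ++ encodeNat i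

/-- The description of a circuit: the number of wires followed by the gates. -/
def QCircuit.encode (C : QCircuit) : List Bool :=
  encodeNat C.width ++ C.gates.flatMap Gate.encode

/-- A quantum polynomial-time algorithm which on the classical input `x` acts from `n x` to `m x`
qubits, given as a family of circuits whose descriptions are computed from `x` in deterministic
polynomial time. -/
def QPT (n m : List Bool → ℕ) (C : List Bool → QCircuit) : Prop :=
  PolyTime (fun x => (C x).encode) ∧ ∀ x, (C x).Valid (n x) (m x)

/-- The class BQP: languages decided by a quantum polynomial-time algorithm with error at most
`1/3` on every input. (The unique state of zero qubits is the `1 × 1` matrix `1`.) -/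
def BQP : Set (Language Bool) :=
  {L | ∃ C : List Bool → QCircuit, QPT (fun _ => 0) (fun _ => 1) C ∧
    (∀ x ∈ L, 2 / 3 ≤ probOne ((C x).channel 0 1 1)) ∧
    (∀ x ∉ L, probOne ((C x).channel 0 1 1) ≤ 1 / 3)}

/-! ### Computational indistinguishability of channels -/

/-- Negligible functions. -/
def Negligible (μ : ℕ → ℝ) : Prop :=
  Asymptotics.SuperpolynomialDecay Filter.atTop (fun n : ℕ => (n : ℝ)) μ

/-- Computational indistinguishability of two families of superoperators, indexed by `x ∈ L`:
circuits of polynomial size that are given the output of the superoperator, applied to a part of an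
arbitrary state, together with the rest of this state (`k` qubits, `k` polynomially bounded), have
only negligible distinguishing advantage. Circuits and states need not be uniform in `x`. -/
def CompIndist (L : Language Bool) (n m : List Bool → ℕ)
    (Ψ Φ : (x : List Bool) → Op (n x) → Op (m x)) : Prop :=
  ∀ q : Polynomial ℕ, ∃ μ : ℕ → ℝ, Negligible μ ∧
    ∀ x ∈ L, ∀ k ≤ q.eval x.length, ∀ D : QCircuit, D.Valid (m x + k) 1 →
      D.size ≤ q.eval x.length → ∀ σ : Op₂ (n x) k, IsState σ →
        |probOne (D.channel (m x + k) 1 (joinOp (tensorId (Ψ x) k σ))) -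
          probOne (D.channel (m x + k) 1 (joinOp (tensorId (Φ x) k σ)))| ≤ μ x.length

/-! ### Two-message quantum proof systems -/

/-- The strategy of a (possibly malicious) verifier in a protocol where on input `x` the verifier
sends `p x` qubits to the prover, and the prover answers with `r x` qubits. The verifier starts with
an auxiliary register of `e x` qubits and ends with an output register of `o x` qubits. The circuit
`first` maps the auxiliary register to the message and a private register of `priv x` qubits; the
circuit `second` maps the answer and the private register to the output. -/
structure VerifierStrategy (e p r o : List Bool → ℕ) : Type where
  priv : List Bool → ℕ
  first : List Bool → QCircuit
  second : List Bool → QCircuit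

/-- The verifier runs in quantum polynomial time. -/
structure VerifierStrategy.IsQPT {e p r o : List Bool → ℕ} (V : VerifierStrategy e p r o) :
    Prop where
  aux_length : PolyTimeLength e
  output_length : PolyTimeLength o
  priv_length : PolyTimeLength V.priv
  first_qpt : QPT e (fun x => p x + V.priv x) V.first
  second_qpt : QPT (fun x => r x + V.priv x) o V.second

/-- The map from the auxiliary register to the output register of the verifier that is induced by
the interaction, on input `x`, with a prover who applies `P` to the verifier's message. -/
noncomputable def VerifierStrategy.interact {e p r o : List Bool → ℕ}
    (V : VerifierStrategy e p r o) (x : List Bool) (P : Op (p x) → Op (r x)) (ρ : Op (e x)) :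
    Op (o x) :=
  (V.second x).channel (r x + V.priv x) (o x)
    (joinOp (tensorId P (V.priv x)
      (splitOp ((V.first x).channel (e x) (p x + V.priv x) ρ))))

/-- A two-message quantum protocol between a prover of unlimited power, who on input `x` applies an
arbitrary channel to the verifier's message, and a quantum polynomial-time verifier, who has no
auxiliary input and outputs one bit. -/
structure TwoMessageProtocol : Type where
  /-- The number of qubits sent by the verifier. -/
  msg : List Bool → ℕ
  /-- The number of qubits sent by the prover. -/
  ans : List Bool → ℕ
  msg_length : PolyTimeLength msg
  ans_length : PolyTimeLength ans
  verifier : VerifierStrategy (fun _ => 0) msg ans (fun _ => 1)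
  verifier_qpt : verifier.IsQPT
  prover : (x : List Bool) → Op (msg x) → Op (ans x)
  prover_channel : ∀ x, IsChannel (prover x)

namespace TwoMessageProtocol

/-- The probability that the honest verifier accepts `x` when interacting with a prover who applies
`P` to the verifier's message. -/
noncomputable def acceptProb (Pi : TwoMessageProtocol) (x : List Bool)
    (P : Op (Pi.msg x) → Op (Pi.ans x)) : ℝ :=
  probOne (Pi.verifier.interact x P 1)

/-- `δ`-correctness for the language `L`. -/
def Correct (Pi : TwoMessageProtocol) (L : Language Bool) (δ : ℝ) : Prop :=
  ∀ x ∈ L, δ ≤ Pi.acceptProb x (Pi.prover x)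

/-- Computational `ε`-soundness for the language `L`: no quantum polynomial-time prover makes the
verifier accept some `x ∉ L` with probability larger than `ε`. -/
def CompSound (Pi : TwoMessageProtocol) (L : Language Bool) (ε : ℝ) : Prop :=
  ∀ C : List Bool → QCircuit, QPT Pi.msg Pi.ans C →
    ∀ x ∉ L, Pi.acceptProb x ((C x).channel (Pi.msg x) (Pi.ans x)) ≤ ε

/-- Computational (auxiliary-input) quantum zero-knowledge for the language `L`: for every quantum
polynomial-time verifier there is a quantum polynomial-time simulator such that the interaction of
the verifier with the honest prover and the simulator are computationally indistinguishable as
channels acting on the auxiliary register of the verifier. -/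
def CompZeroKnowledge (Pi : TwoMessageProtocol) (L : Language Bool) : Prop :=
  ∀ (e o : List Bool → ℕ) (V : VerifierStrategy e Pi.msg Pi.ans o), V.IsQPT →
    ∃ S : List Bool → QCircuit, QPT e o S ∧
      CompIndist L e o (fun x => V.interact x (Pi.prover x))
        (fun x => (S x).channel (e x) (o x))

end TwoMessageProtocol

/-! Zero-knowledge makes the honest prover replaceable by an efficient one. Consider the malicious
verifier that sends its auxiliary register to the prover and outputs the answer. Its interaction
with the honest prover is the prover's channel itself, so its simulator `S` is a QPT channel that is
indistinguishable from the prover's channel, even on messages entangled with a register kept by the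
distinguisher.

Let `S` play the prover against the honest verifier. The verifier's second circuit, which holds the
answer and the private register, is an admissible distinguisher, and the joint state after the first
circuit is an admissible input. Hence for `x ∈ L` the acceptance probability `a x` is at least `2/3`
minus a negligible error. For `x ∉ L` soundness applies to `S`, since it is a QPT prover, and gives
`a x ≤ ε`.

Since `BQP` demands exactly `2/3` and `1/3`, the error has to be removed
(`mem_BQP_of_isAcceptProb`). No amplification by repetition is needed: accepting if either the run
or an independent coin of small constant bias `η` accepts gives `1 - (1 - a x) (1 - η)`. This stays
below `1/3` on no-instances, as `ε < 1/3` is constant, and gains about `η / 3` on yes-instances,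
which beats the error for all but finitely many lengths. The remaining inputs are hard-wired.

Most of the work shows that verifier and simulator together form one QPT algorithm
(`isAcceptProb_interact`). On the classical side, the description of the composite circuit must be
computable by a stack program; all wire renamings are composed from `insertWires`, so one text
transformation suffices (`PolyTime.map_insertWires`, `polyTime_interact`). On the quantum side,
circuits on overlapping sets of wires of a large register must compose as channels
(`reduceOp_conj_circuit`, `probOne_interact`); this rests on the duality `trace_mul_reduceOp`
between tensoring with the identity and the partial trace. -/

/-! ### Bounded runs of stack programs -/

namespace StackProg

/-- Started on `s`, the program `c` halts within `T` steps with the stacks `s'`. -/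
def Reaches (c : StackProg) (s : Store) (T : ℕ) (s' : Store) : Prop :=
  ∃ t ≤ T, c.Runs s t s'

theorem Reaches.mono {c : StackProg} {s s' : Store} {T T' : ℕ} (h : c.Reaches s T s')
    (hT : T ≤ T') : c.Reaches s T' s' :=
  let ⟨t, ht, hr⟩ := h
  ⟨t, ht.trans hT, hr⟩

theorem Reaches.skip (s : Store) : skip.Reaches s 1 s := ⟨1, le_rfl, .skip s⟩

theorem Reaches.push (b : Bool) (r : ℕ) (s : Store) :
    (push b r).Reaches s 1 (Function.update s r (b :: s r)) := ⟨1, le_rfl, .push b r s⟩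

theorem Reaches.pop (r : ℕ) (s : Store) :
    (pop r).Reaches s 1 (Function.update s r (s r).tail) := ⟨1, le_rfl, .pop r s⟩

theorem Reaches.seq {a b : StackProg} {s s' s'' : Store} {T T' : ℕ} (ha : a.Reaches s T s')
    (hb : b.Reaches s' T' s'') : (seq a b).Reaches s (T + T') s'' :=
  let ⟨t, ht, hr⟩ := ha
  let ⟨t', ht', hr'⟩ := hb
  ⟨t + t', add_le_add ht ht', .seq hr hr'⟩

theorem Reaches.branch_empty {r : ℕ} {a b c : StackProg} {s s' : Store} {T : ℕ}
    (h : s r = []) (ha : a.Reaches s T s') : (branch r a b c).Reaches s (T + 1) s' :=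
  let ⟨t, ht, hr⟩ := ha
  ⟨t + 1, by omega, .branch_empty h hr⟩

theorem Reaches.branch_false {r : ℕ} {a b c : StackProg} {s s' : Store} {T : ℕ} {l : List Bool}
    (h : s r = false :: l) (hb : b.Reaches s T s') : (branch r a b c).Reaches s (T + 1) s' :=
  let ⟨t, ht, hr⟩ := hb
  ⟨t + 1, by omega, .branch_false (by simp [h]) hr⟩

theorem Reaches.branch_true {r : ℕ} {a b c : StackProg} {s s' : Store} {T : ℕ} {l : List Bool}
    (h : s r = true :: l) (hc : c.Reaches s T s') : (branch r a b c).Reaches s (T + 1) s' :=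
  let ⟨t, ht, hr⟩ := hc
  ⟨t + 1, by omega, .branch_true (by simp [h]) hr⟩

theorem Reaches.loop_empty {r : ℕ} {a : StackProg} {s : Store} (h : s r = []) :
    (loop r a).Reaches s 1 s := ⟨1, le_rfl, Runs.loop_stop h⟩

theorem Reaches.loop_step {r : ℕ} {a : StackProg} {s s' s'' : Store} {T T' : ℕ}
    (h : s r ≠ []) (ha : a.Reaches s T s') (hl : (loop r a).Reaches s' T' s'') :
    (loop r a).Reaches s (T + T' + 1) s'' :=
  let ⟨t, ht, hr⟩ := ha
  let ⟨t', ht', hr'⟩ := hl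
  ⟨t + t' + 1, by omega, .loop_step h hr hr'⟩

/-- Space is bounded by time, because one step adds at most one bit to a stack. This bounds the
output length of polynomial-time functions. -/
theorem Runs.length_le {c : StackProg} {s s' : Store} {t : ℕ} (h : c.Runs s t s') (r : ℕ) :
    (s' r).length ≤ (s r).length + t := by
  induction h with
  | skip s => omega
  | push b k s =>
    by_cases hk : r = k
    · subst hk; simp
    · simp [hk]
  | pop k s =>
    by_cases hk : r = k
    · subst hk; simp; omega
    · simp [hk]
  | seq _ _ h₁ h₂ => omega
  | branch_empty _ _ h => omega
  | branch_false _ _ h => omega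
  | branch_true _ _ h => omega
  | loop_stop _ => omega
  | loop_step _ _ _ h₁ h₂ => omega

/-- Rename the stacks of a program. -/
def rename (f : ℕ → ℕ) : StackProg → StackProg
  | skip => skip
  | push b r => push b (f r)
  | pop r => pop (f r)
  | seq a b => seq (a.rename f) (b.rename f)
  | branch r a b c => branch (f r) (a.rename f) (b.rename f) (c.rename f)
  | loop r a => loop (f r) (a.rename f)

/-- A renamed program sees the store only through `f`. The last clause, that stacks outside the
range of `f` survive, lets several programs coexist on disjoint sets of stacks. -/
theorem Runs.rename {f : ℕ → ℕ} (hf : Function.Injective f) {c : StackProg} {s s' : Store} {t : ℕ}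
    (h : c.Runs s t s') : ∀ S : Store, (∀ r, S (f r) = s r) → ∃ S' : Store,
      (c.rename f).Runs S t S' ∧ (∀ r, S' (f r) = s' r) ∧ ∀ r ∉ Set.range f, S' r = S r := by
  induction h with
  | skip s => exact fun S hS => ⟨S, .skip S, hS, fun _ _ => rfl⟩
  | push b k s =>
    refine fun S hS => ⟨_, .push b (f k) S, fun r => ?_, fun r hr => ?_⟩
    · by_cases hk : r = k
      · subst hk; simp [hS]
      · simp [hk, hf.ne hk, hS]
    · rw [Function.update_of_ne]
      rintro rfl
      exact hr ⟨k, rfl⟩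
  | pop k s =>
    refine fun S hS => ⟨_, .pop (f k) S, fun r => ?_, fun r hr => ?_⟩
    · by_cases hk : r = k
      · subst hk; simp [hS]
      · simp [hk, hf.ne hk, hS]
    · rw [Function.update_of_ne]
      rintro rfl
      exact hr ⟨k, rfl⟩
  | seq _ _ h₁ h₂ =>
    intro S hS
    obtain ⟨S₁, r₁, e₁, o₁⟩ := h₁ S hS
    obtain ⟨S₂, r₂, e₂, o₂⟩ := h₂ S₁ e₁
    exact ⟨S₂, .seq r₁ r₂, e₂, fun r hr => (o₂ r hr).trans (o₁ r hr)⟩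
  | branch_empty hs _ h₁ =>
    intro S hS
    obtain ⟨S₁, r₁, e₁, o₁⟩ := h₁ S hS
    exact ⟨S₁, .branch_empty (by rw [hS, hs]) r₁, e₁, o₁⟩
  | branch_false hs _ h₁ =>
    intro S hS
    obtain ⟨S₁, r₁, e₁, o₁⟩ := h₁ S hS
    exact ⟨S₁, .branch_false (by rw [hS, hs]) r₁, e₁, o₁⟩
  | branch_true hs _ h₁ =>
    intro S hS
    obtain ⟨S₁, r₁, e₁, o₁⟩ := h₁ S hS
    exact ⟨S₁, .branch_true (by rw [hS, hs]) r₁, e₁, o₁⟩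
  | loop_stop hs => exact fun S hS => ⟨S, Runs.loop_stop (by rw [hS, hs]), hS, fun _ _ => rfl⟩
  | loop_step hs _ _ h₁ h₂ =>
    intro S hS
    obtain ⟨S₁, r₁, e₁, o₁⟩ := h₁ S hS
    obtain ⟨S₂, r₂, e₂, o₂⟩ := h₂ S₁ e₁
    exact ⟨S₂, .loop_step (by rwa [hS]) r₁ r₂, e₂, fun r hr => (o₂ r hr).trans (o₁ r hr)⟩

theorem Reaches.rename {f : ℕ → ℕ} (hf : Function.Injective f) {c : StackProg} {s s' : Store}
    {T : ℕ} (h : c.Reaches s T s') (S : Store) (hS : ∀ r, S (f r) = s r) : ∃ S' : Store,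
      (c.rename f).Reaches S T S' ∧ (∀ r, S' (f r) = s' r) ∧ ∀ r ∉ Set.range f, S' r = S r := by
  obtain ⟨t, ht, hr⟩ := h
  obtain ⟨S', h₁, h₂, h₃⟩ := hr.rename hf S hS
  exact ⟨S', ⟨t, ht, h₁⟩, h₂, h₃⟩

/-! ### Moving and duplicating stacks. -/

/-- Move the contents of stack `a` to stack `b`, in reversed order. -/
def move (a b : ℕ) : StackProg :=
  loop a (branch a skip (seq (pop a) (push false b)) (seq (pop a) (push true b)))

theorem reaches_move {a b : ℕ} (hab : a ≠ b) (s : Store) : (move a b).Reaches s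
    (4 * (s a).length + 1)
    (Function.update (Function.update s a []) b ((s a).reverse ++ s b)) := by
  obtain ⟨l, hl⟩ : ∃ l, s a = l := ⟨_, rfl⟩
  induction l generalizing s with
  | nil =>
    rw [show Function.update (Function.update s a []) b ((s a).reverse ++ s b) = s by
      rw [hl]; ext r; by_cases h : r = b
      · simp [h]
      · by_cases h' : r = a
        · subst h'; simp [h, hl]
        · simp [h, h']]
    exact (Reaches.loop_empty hl).mono (by omega)
  | cons c l ih =>
    have key : (branch a StackProg.skip (.seq (.pop a) (.push false b))
        (.seq (.pop a) (.push true b))).Reaches s 3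
          (Function.update (Function.update s a l) b (c :: s b)) := by
      have := (Reaches.pop a s).seq (.push c b _)
      rw [hl, Function.update_of_ne hab.symm, List.tail_cons] at this
      cases c
      · exact Reaches.branch_false hl this
      · exact Reaches.branch_true hl this
    have := ih (Function.update (Function.update s a l) b (c :: s b)) (by simp [hab])
    have hstep := (Reaches.loop_step (by simp [hl]) key this).mono (T' := 4 * (s a).length + 1)
      (by simp [hab, hl]; omega)
    unfold move
    convert hstep using 1
    ext r; by_cases h : r = b
    · simp [h, hl, hab]
    · by_cases h' : r = a
      · subst h'; simp [h]
      · simp [h, h']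

/-- Move the contents of stack `a` to the stacks `b` and `c`, in reversed order. -/
def moveTwo (a b c : ℕ) : StackProg :=
  loop a (branch a skip (seq (pop a) (seq (push false b) (push false c)))
    (seq (pop a) (seq (push true b) (push true c))))

theorem reaches_moveTwo {a b c : ℕ} (hab : a ≠ b) (hac : a ≠ c) (hbc : b ≠ c) (s : Store) :
    (moveTwo a b c).Reaches s (5 * (s a).length + 1)
    (Function.update (Function.update (Function.update s a []) b ((s a).reverse ++ s b)) c
      ((s a).reverse ++ s c)) := by
  obtain ⟨l, hl⟩ : ∃ l, s a = l := ⟨_, rfl⟩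
  induction l generalizing s with
  | nil =>
    rw [show Function.update (Function.update (Function.update s a []) b ((s a).reverse ++ s b)) c
      ((s a).reverse ++ s c) = s by
      rw [hl]; ext r
      by_cases h'' : r = c
      · simp [h'']
      by_cases h : r = b
      · simp [h, hbc]
      · by_cases h' : r = a
        · subst h'; simp [h, h'', hl]
        · simp [h, h', h'']]
    exact (Reaches.loop_empty hl).mono (by omega)
  | cons d l ih =>
    have key : (branch a StackProg.skip (.seq (.pop a) (.seq (.push false b) (.push false c)))
        (.seq (.pop a) (.seq (.push true b) (.push true c)))).Reaches s 4
          (Function.update (Function.update (Function.update s a l) b (d :: s b)) c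
            (d :: s c)) := by
      have := (Reaches.pop a s).seq ((Reaches.push d b _).seq (.push d c _))
      rw [hl, Function.update_of_ne hab.symm, List.tail_cons, Function.update_of_ne hbc.symm,
        Function.update_of_ne hac.symm] at this
      cases d
      · exact Reaches.branch_false hl this
      · exact Reaches.branch_true hl this
    have := ih (Function.update (Function.update (Function.update s a l) b (d :: s b)) c
            (d :: s c)) (by simp [hab, hac])
    have hstep := (Reaches.loop_step (by simp [hl]) key this).mono (T' := 5 * (s a).length + 1)
      (by simp [hab, hac, hl]; omega)
    unfold moveTwo
    convert hstep using 1
    ext r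
    by_cases h'' : r = c
    · simp [h'', hl, hac, hab]
    by_cases h : r = b
    · simp [h, hl, hab, hac, hbc]
    · by_cases h' : r = a
      · subst h'; simp [h, h'']
      · simp [h, h', h'']

end StackProg

/-! ### Closure properties of polynomial time -/

theorem Polynomial.eval_nat_mono (q : Polynomial ℕ) : Monotone fun n => q.eval n := by
  intro a b hab
  simp only [Polynomial.eval_eq_sum, Polynomial.sum]
  gcongr

open StackProg

theorem PolyTime.of_reaches {f : List Bool → List Bool} (c : StackProg) (q : Polynomial ℕ)
    (h : ∀ x, ∃ s, c.Reaches (inputStore x) (q.eval x.length) s ∧ s 1 = f x) : PolyTime f :=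
  ⟨c, q, fun x => let ⟨s, ⟨t, ht, hr⟩, hs⟩ := h x; ⟨t, s, hr, ht, hs⟩⟩

theorem PolyTime.reaches {f : List Bool → List Bool} (h : PolyTime f) :
    ∃ (c : StackProg) (q : Polynomial ℕ), ∀ x, (f x).length ≤ q.eval x.length ∧
      ∃ s, c.Reaches (inputStore x) (q.eval x.length) s ∧ s 1 = f x := by
  obtain ⟨c, q, h⟩ := h
  refine ⟨c, q, fun x => ?_⟩
  obtain ⟨t, s, hr, ht, hs⟩ := h x
  refine ⟨?_, s, ⟨t, ht, hr⟩, hs⟩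
  have := hr.length_le 1
  simp [inputStore, hs] at this
  omega

theorem PolyTime.length_le {f : List Bool → List Bool} (h : PolyTime f) :
    ∃ q : Polynomial ℕ, ∀ x, (f x).length ≤ q.eval x.length :=
  let ⟨_, q, h⟩ := h.reaches
  ⟨q, fun x => (h x).1⟩

/-- The stacks are divided by residue modulo 3: the program for `f` uses class 0, the program `c`
uses class 2, and class 1 serves as scratch space and contains the output stack. -/
theorem PolyTime.trans {f h : List Bool → List Bool} (hf : PolyTime f) (c : StackProg)
    (q : Polynomial ℕ)
    (hc : ∀ x, ∃ s, c.Reaches (inputStore (f x)) (q.eval (f x).length) s ∧ s 1 = h x) :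
    PolyTime h := by
  obtain ⟨cf, qf, hf⟩ := hf.reaches
  -- Stack 1 of the first program is stack 3, and stacks 0 and 1 of the second are stacks 2 and 5. A
  -- move reverses the contents, so every transfer is done in two moves.
  refine .of_reaches (.seq (cf.rename (3 * ·)) (.seq (move 3 1) (.seq (move 1 2)
    (.seq (c.rename (3 * · + 2)) (.seq (move 5 4) (move 4 1))))))
    (qf + ((4 * qf + 1) + ((4 * qf + 1) + (q.comp qf + ((4 * q.comp qf + 1) +
      (4 * q.comp qf + 1)))))) fun x => ?_
  obtain ⟨hlen, s, hr, hs⟩ := hf x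
  obtain ⟨s', hr', hs'⟩ := hc x
  have hq : q.eval (f x).length ≤ (q.comp qf).eval x.length := by
    rw [Polynomial.eval_comp]; exact q.eval_nat_mono hlen
  have hlen' : (h x).length ≤ (q.comp qf).eval x.length := by
    obtain ⟨t, ht, hr'⟩ := hr'
    have := hr'.length_le 1
    simp [inputStore, hs'] at this
    omega
  obtain ⟨S₁, r₁, e₁, o₁⟩ := hr.rename (f := (3 * ·)) (fun a b => by simp) (inputStore x)
    (fun r => by cases r <;> simp [inputStore])
  have o₁' : ∀ r, r % 3 ≠ 0 → S₁ r = [] := by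
    intro r hr
    rw [o₁ r (by rintro ⟨k, rfl⟩; simp at hr), inputStore, if_neg (by rintro rfl; simp at hr)]
  have hS₁ : S₁ 3 = f x := (e₁ 1).trans hs
  have r₂ := reaches_move (a := 3) (b := 1) (by decide) S₁
  rw [hS₁, o₁' 1 (by decide), List.append_nil] at r₂
  have r₃ := reaches_move (a := 1) (b := 2) (by decide)
    (Function.update (Function.update S₁ 3 []) 1 (f x).reverse)
  simp only [Function.update_self, List.reverse_reverse, List.length_reverse] at r₃
  rw [Function.update_of_ne (by decide), Function.update_of_ne (by decide), o₁' 2 (by decide),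
    List.append_nil] at r₃
  obtain ⟨S₂, hS₂⟩ : ∃ S₂, Function.update (Function.update (Function.update
    (Function.update S₁ 3 []) 1 (f x).reverse) 1 []) 2 (f x) = S₂ := ⟨_, rfl⟩
  rw [hS₂] at r₃
  have e₂ : ∀ r, S₂ (3 * r + 2) = inputStore (f x) r := by
    intro r
    rcases r with _ | r
    · simp [← hS₂, inputStore]
    · rw [← hS₂]
      simp only [Function.update_apply, inputStore]
      rw [if_neg (by omega), if_neg (by omega), if_neg (by omega), if_neg (by omega),
        o₁' _ (by omega), if_neg (by omega)]
  obtain ⟨S₃, r₄, e₃, o₃⟩ := hr'.rename (f := (3 * · + 2)) (fun a b => by simp) S₂ e₂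
  have h5 : S₃ 5 = h x := (e₃ 1).trans hs'
  have h4 : S₃ 4 = [] := by
    rw [o₃ 4 (by rintro ⟨k, hk⟩; simp only at hk; omega), ← hS₂]
    simp [o₁' 4]
  have h1 : S₃ 1 = [] := by
    rw [o₃ 1 (by rintro ⟨k, hk⟩; simp only at hk; omega), ← hS₂]
    simp
  have r₅ := reaches_move (a := 5) (b := 4) (by decide) S₃
  rw [h5, h4, List.append_nil] at r₅
  have r₆ := reaches_move (a := 4) (b := 1) (by decide)
    (Function.update (Function.update S₃ 5 []) 4 (h x).reverse)
  refine ⟨_, (r₁.seq (r₂.seq (r₃.seq (r₄.seq (r₅.seq r₆))))).mono ?_, ?_⟩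
  · simp only [Polynomial.eval_add, Polynomial.eval_mul, Polynomial.eval_ofNat,
      Polynomial.eval_one, Function.update_self, List.length_reverse]
    gcongr
  · simp [h1]

/-- The input is copied to stacks 2 and 3, and the two programs run on residue classes 2 and 0. The
value of `g` is delivered to stack 1 first, because a later move puts its bits on top. -/
theorem PolyTime.append {f g : List Bool → List Bool} (hf : PolyTime f) (hg : PolyTime g) :
    PolyTime fun x => f x ++ g x := by
  obtain ⟨cf, qf, hf⟩ := hf.reaches
  obtain ⟨cg, qg, hg⟩ := hg.reaches
  refine .of_reaches (.seq (move 0 1) (.seq (moveTwo 1 2 3) (.seq (cf.rename (3 * · + 2))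
    (.seq (cg.rename (3 * · + 3)) (.seq (move 6 4) (.seq (move 4 1)
      (.seq (move 5 4) (move 4 1))))))))
    ((4 * Polynomial.X + 1) + ((5 * Polynomial.X + 1) + (qf + (qg + ((4 * qg + 1) +
      ((4 * qg + 1) + ((4 * qf + 1) + (4 * qf + 1)))))))) fun x => ?_
  obtain ⟨hlf, s, hr, hs⟩ := hf x
  obtain ⟨hlg, s', hr', hs'⟩ := hg x
  have r₀ := reaches_move (a := 0) (b := 1) (by decide) (inputStore x)
  have r₁ := reaches_moveTwo (a := 1) (b := 2) (c := 3) (by decide) (by decide) (by decide)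
    (Function.update (Function.update (inputStore x) 0 []) 1
      ((inputStore x 0).reverse ++ inputStore x 1))
  have i0 : inputStore x 0 = x := rfl
  have i1 : inputStore x 1 = [] := rfl
  have i2 : inputStore x 2 = [] := rfl
  have i3 : inputStore x 3 = [] := rfl
  simp only [i0, i1, Function.update_self, List.reverse_reverse, List.length_reverse,
    List.append_nil] at r₀ r₁
  rw [Function.update_of_ne (by decide), Function.update_of_ne (by decide),
    Function.update_of_ne (by decide), Function.update_of_ne (by decide), i2, i3,
    List.append_nil] at r₁
  obtain ⟨S₁, hS₁⟩ : ∃ S₁, Function.update (Function.update (Function.update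
    (Function.update (Function.update (inputStore x) 0 []) 1 x.reverse) 1 []) 2 x) 3 x = S₁ :=
    ⟨_, rfl⟩
  rw [hS₁] at r₁
  have o₁ : ∀ r, r ≠ 2 → r ≠ 3 → S₁ r = [] := by
    intro r h2 h3
    rw [← hS₁]
    simp only [Function.update_apply, inputStore, h2, h3]
    split_ifs <;> first | rfl | contradiction
  have i2 : S₁ 2 = x := by simp [← hS₁]
  have i3 : S₁ 3 = x := by simp [← hS₁]
  obtain ⟨S₂, r₂, e₂, o₂⟩ := hr.rename (f := (3 * · + 2)) (fun a b => by simp) S₁ (by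
    rintro (_ | r)
    · simpa [inputStore] using i2
    · rw [o₁ _ (by omega) (by omega)]; rfl)
  have o₂' : ∀ r, r % 3 ≠ 2 → S₂ r = S₁ r := fun r hr => o₂ r (by rintro ⟨k, rfl⟩; simp at hr)
  obtain ⟨S₃, r₃, e₃, o₃⟩ := hr'.rename (f := (3 * · + 3)) (fun a b => by simp) S₂ (by
    rintro (_ | r)
    · rw [o₂' _ (by omega)]
      simpa [inputStore] using i3
    · rw [o₂' _ (by omega), o₁ _ (by omega) (by omega)]; rfl)
  have o₃' : ∀ r, r % 3 ≠ 0 → S₃ r = S₂ r := fun r hr => o₃ r (by rintro ⟨k, rfl⟩; simp at hr)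
  have h6 : S₃ 6 = g x := (e₃ 1).trans hs'
  have h5 : S₃ 5 = f x := by rw [o₃' 5 (by decide)]; exact (e₂ 1).trans hs
  have h4 : S₃ 4 = [] := by
    rw [o₃' 4 (by decide), o₂' 4 (by decide), o₁ 4 (by decide) (by decide)]
  have h1 : S₃ 1 = [] := by
    rw [o₃' 1 (by decide), o₂' 1 (by decide), o₁ 1 (by decide) (by decide)]
  refine ⟨_, (r₀.seq (r₁.seq (r₂.seq (r₃.seq ((reaches_move (by decide) _).seq
    ((reaches_move (by decide) _).seq ((reaches_move (by decide) _).seq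
      (reaches_move (by decide) _)))))))).mono ?_, ?_⟩
  · simp [h6, h5, h4, h1]
    omega
  · simp [h6, h5, h4, h1]

theorem PolyTime.const (l : List Bool) : PolyTime fun _ => l := by
  suffices h : ∃ c : StackProg, ∃ T, ∀ s : Store, s 1 = [] → ∃ s', c.Reaches s T s' ∧ s' 1 = l by
    obtain ⟨c, T, h⟩ := h
    refine .of_reaches c (Polynomial.C T) fun x => ?_
    simpa using h (inputStore x) rfl
  induction l with
  | nil => exact ⟨.skip, 1, fun s hs => ⟨s, .skip s, hs⟩⟩
  | cons b l ih =>
    obtain ⟨c, T, h⟩ := ih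
    refine ⟨.seq c (.push b 1), T + 1, fun s hs => ?_⟩
    obtain ⟨s', hr, hs'⟩ := h s hs
    exact ⟨_, hr.seq (.push _ _ _), by simp [hs']⟩

/-- A finite decision tree compares the input with `x₀` bit by bit. It supplies the hard-wiring of
individual inputs. -/
theorem PolyTime.update {f : List Bool → List Bool} (hf : PolyTime f) (x₀ l : List Bool) :
    PolyTime (Function.update f x₀ l) := by
  obtain ⟨c, q, hf⟩ := hf.reaches
  suffices h : ∀ (x₀ : List Bool) (c : StackProg), ∃ (c' : StackProg) (T : ℕ), ∀ x,
      (x = x₀ → ∃ s, c'.Reaches (inputStore x) T s ∧ s 1 = l) ∧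
      ∀ (T' : ℕ) (s : Store), x ≠ x₀ → c.Reaches (inputStore x) T' s →
        c'.Reaches (inputStore x) (T' + T) s by
    obtain ⟨c', T, h⟩ := h x₀ c
    refine .of_reaches c' (q + Polynomial.C T) fun x => ?_
    by_cases hx : x = x₀
    · obtain ⟨s, hr, hs⟩ := (h x).1 hx
      exact ⟨s, hr.mono (by simp), by simp [hx, hs]⟩
    · obtain ⟨-, s, hr, hs⟩ := hf x
      exact ⟨s, by simpa using (h x).2 _ _ hx hr, by simp [hx, hs]⟩
  clear hf c q x₀
  intro x₀
  have hupd : ∀ (b : Bool) (x : List Bool),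
      Function.update (inputStore x) 0 (b :: x) = inputStore (b :: x) := by
    intro b x; ext r; by_cases h : r = 0 <;> simp [h, inputStore]
  have hupd' : ∀ (b : Bool) (x : List Bool),
      Function.update (inputStore (b :: x)) 0 x = inputStore x := by
    intro b x; ext r; by_cases h : r = 0 <;> simp [h, inputStore]
  induction x₀ with
  | nil =>
    intro c
    obtain ⟨cl, ql, hl⟩ := (PolyTime.const l).reaches
    refine ⟨.branch 0 cl c c, ql.eval 0 + 1, fun x => ⟨?_, ?_⟩⟩
    · rintro rfl
      obtain ⟨-, s, hr, hs⟩ := hl []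
      exact ⟨s, .branch_empty rfl hr, hs⟩
    · intro T' s hx hr
      obtain ⟨b, y, rfl⟩ := List.exists_cons_of_ne_nil hx
      cases b
      · exact (Reaches.branch_false (l := y) rfl hr).mono (by omega)
      · exact (Reaches.branch_true (l := y) rfl hr).mono (by omega)
  | cons b₀ x₀ ih =>
    intro c
    -- The comparison destroys the bits it reads, so the fallback program is prefixed with a push
    -- that restores the bit `b₀` popped at this level.
    obtain ⟨c', T, h⟩ := ih (.seq (.push b₀ 0) c)
    have main : ∀ x, (x = x₀ → ∃ s,
        (StackProg.seq (.pop 0) c').Reaches (inputStore (b₀ :: x)) (T + 1) s ∧ s 1 = l) ∧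
        ∀ (T' : ℕ) (s : Store), x ≠ x₀ → c.Reaches (inputStore (b₀ :: x)) T' s →
          (StackProg.seq (.pop 0) c').Reaches (inputStore (b₀ :: x)) (T' + T + 2) s := by
      intro x
      have hpop := Reaches.pop 0 (inputStore (b₀ :: x))
      rw [show (inputStore (b₀ :: x) 0).tail = x from rfl, hupd'] at hpop
      refine ⟨fun hx => ?_, fun T' s hx hr => ?_⟩
      · obtain ⟨s, hr, hs⟩ := (h x).1 hx
        exact ⟨s, (hpop.seq hr).mono (by omega), hs⟩
      · have hpush := Reaches.push b₀ 0 (inputStore x)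
        rw [show inputStore x 0 = x from rfl, hupd] at hpush
        exact (hpop.seq ((h x).2 _ s hx (hpush.seq hr))).mono (by omega)
    refine ⟨.branch 0 c (if b₀ then c else .seq (.pop 0) c') (if b₀ then .seq (.pop 0) c' else c),
      T + 3, fun x => ?_⟩
    rcases x with _ | ⟨b, x⟩
    · exact ⟨by simp, fun T' s _ hr => (Reaches.branch_empty rfl hr).mono (by omega)⟩
    · refine ⟨fun hx => ?_, fun T' s hx hr => ?_⟩
      · obtain ⟨rfl, rfl⟩ := List.cons_eq_cons.1 hx
        obtain ⟨s, hr, hs⟩ := (main x).1 rfl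
        cases b
        · exact ⟨s, (Reaches.branch_false (l := x) rfl hr).mono (by omega), hs⟩
        · exact ⟨s, (Reaches.branch_true (l := x) rfl hr).mono (by omega), hs⟩
      · by_cases hb : b = b₀
        · subst hb
          have := (main x).2 T' s (by simpa using hx) hr
          cases b
          · exact (Reaches.branch_false (l := x) rfl this).mono (by omega)
          · exact (Reaches.branch_true (l := x) rfl this).mono (by omega)
        · cases b <;> cases b₀ <;> simp at hb
          · exact (Reaches.branch_false (l := x) rfl hr).mono (by omega)
          · exact (Reaches.branch_true (l := x) rfl hr).mono (by omega)

/-! ### Programs that manipulate descriptions of circuits -/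

/-- The store with the given stacks; all other stacks are empty. -/
def Store.ofList (l : List (List Bool)) : Store := fun r => l.getD r []

/-- Stores given by explicit lists turn symbolic execution into computation with `List.set` and
`List.getD`. -/
theorem Store.update_ofList {l : List (List Bool)} {r : ℕ} (h : r < l.length) (v : List Bool) :
    Function.update (Store.ofList l) r v = Store.ofList (l.set r v) := by
  ext k
  by_cases hk : k = r
  · subst hk; simp [ofList, h]
  · simp [ofList, hk, Ne.symm hk]

theorem inputStore_eq_ofList (x : List Bool) (n : ℕ) :
    inputStore x = Store.ofList (x :: List.replicate n []) := by
  ext k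
  rcases k with _ | k
  · simp [inputStore, Store.ofList]
  · by_cases h : k < n <;> simp [inputStore, Store.ofList, h]

namespace StackProg

variable {l : List (List Bool)} {a b c : ℕ}

theorem Reaches.push_ofList (v : Bool) (ha : a < l.length) :
    (StackProg.push v a).Reaches (Store.ofList l) 1 (Store.ofList (l.set a (v :: l.getD a []))) := by
  rw [← Store.update_ofList ha]
  exact .push v a _

theorem Reaches.pop_ofList (ha : a < l.length) :
    (StackProg.pop a).Reaches (Store.ofList l) 1 (Store.ofList (l.set a (l.getD a []).tail)) := by
  rw [← Store.update_ofList ha]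
  exact .pop a _

theorem reaches_move_ofList (hab : a ≠ b) (ha : a < l.length) (hb : b < l.length) :
    (move a b).Reaches (Store.ofList l) (4 * (l.getD a []).length + 1)
      (Store.ofList ((l.set a []).set b ((l.getD a []).reverse ++ l.getD b []))) := by
  rw [← Store.update_ofList (by simpa), ← Store.update_ofList ha]
  exact reaches_move hab _

theorem reaches_moveTwo_ofList (hab : a ≠ b) (hac : a ≠ c) (hbc : b ≠ c) (ha : a < l.length)
    (hb : b < l.length) (hc : c < l.length) :
    (moveTwo a b c).Reaches (Store.ofList l) (5 * (l.getD a []).length + 1)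
      (Store.ofList (((l.set a []).set b ((l.getD a []).reverse ++ l.getD b [])).set c
        ((l.getD a []).reverse ++ l.getD c []))) := by
  rw [← Store.update_ofList (by simpa), ← Store.update_ofList (by simpa), ← Store.update_ofList ha]
  exact reaches_moveTwo hab hac hbc _

/-- Move the unary number on top of stack `0` to stack `2`. -/
def readNat : StackProg :=
  seq (push true 5) (loop 5 (branch 0 (pop 5) (seq (pop 0) (pop 5)) (seq (pop 0) (push true 2))))

/-- Since `loop` only tests for emptiness, a flag on stack 5 keeps the loop alive until the
separator `false` has been read. -/
theorem reaches_readNat (n : ℕ) (d s₁ s₂ s₃ s₄ s₆ s₇ : List Bool) :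
    readNat.Reaches (Store.ofList [encodeNat n ++ d, s₁, s₂, s₃, s₄, [], s₆, s₇]) (4 * n + 6)
      (Store.ofList [d, s₁, List.replicate n true ++ s₂, s₃, s₄, [], s₆, s₇]) := by
  refine (Reaches.seq (s' := Store.ofList [encodeNat n ++ d, s₁, s₂, s₃, s₄, [true], s₆, s₇])
    (T' := 4 * n + 5) (.push_ofList true (by simp)) ?_).mono (by omega)
  induction n generalizing s₂ with
  | zero =>
    have h : (branch 0 (pop 5) (seq (pop 0) (pop 5)) (seq (pop 0) (push true 2))).Reaches
        (Store.ofList [false :: d, s₁, s₂, s₃, s₄, [true], s₆, s₇]) 3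
        (Store.ofList [d, s₁, s₂, s₃, s₄, [], s₆, s₇]) :=
      .branch_false rfl (.seq
        (s' := Store.ofList [d, s₁, s₂, s₃, s₄, [true], s₆, s₇])
        (.pop_ofList (l := [false :: d, s₁, s₂, s₃, s₄, [true], s₆, s₇]) (by simp))
        (.pop_ofList (l := [d, s₁, s₂, s₃, s₄, [true], s₆, s₇]) (by simp)))
    exact (Reaches.loop_step (List.cons_ne_nil _ _) h (Reaches.loop_empty rfl)).mono (by omega)
  | succ n ih =>
    have h : (branch 0 (pop 5) (seq (pop 0) (pop 5)) (seq (pop 0) (push true 2))).Reaches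
        (Store.ofList [encodeNat (n + 1) ++ d, s₁, s₂, s₃, s₄, [true], s₆, s₇]) 3
        (Store.ofList [encodeNat n ++ d, s₁, true :: s₂, s₃, s₄, [true], s₆, s₇]) :=
      .branch_true rfl (.seq
        (s' := Store.ofList [encodeNat n ++ d, s₁, s₂, s₃, s₄, [true], s₆, s₇])
        (.pop_ofList (l := [encodeNat (n + 1) ++ d, s₁, s₂, s₃, s₄, [true], s₆, s₇]) (by simp))
        (.push_ofList (l := [encodeNat n ++ d, s₁, s₂, s₃, s₄, [true], s₆, s₇]) true (by simp)))
    have := Reaches.loop_step (List.cons_ne_nil _ _) h (ih (true :: s₂))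
    rw [List.append_cons, ← List.replicate_succ'] at this
    exact this.mono (by omega)

end StackProg

/-! ### Inserting wires -/

/-- The new name of wire `i` after the insertion of `s` wires at position `t`. -/
def insertWires (t s i : ℕ) : ℕ := if i < t then i else i + s

/-- Rename the wires of a gate. -/
def Gate.map (f : ℕ → ℕ) : Gate → Gate
  | .had i => .had (f i)
  | .phase i => .phase (f i)
  | .not i => .not (f i)
  | .cnot c i => .cnot (f c) (f i)
  | .toffoli c d i => .toffoli (f c) (f d) (f i)

namespace StackProg

/-- Copy the unary number on top of stack `0` to stack `4`, adding the length of stack `3` if the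
number is at least the length of stack `2`. -/
def shiftNat : StackProg :=
  seq (push true 5) (seq
    (loop 5 (branch 0 (pop 5) (seq (pop 0) (pop 5)) (seq (pop 0) (seq (push true 4)
      (branch 2 skip skip (seq (pop 2) (push true 6)))))))
    (seq (branch 2 (seq (moveTwo 3 7 4) (move 7 3)) skip skip)
      (seq (move 6 2) (push false 4))))

/-- Each unit of `i` cancels one unit of `t` on stack 2, which is saved on stack 6. Afterwards stack
2 holds the truncated difference `t - i`, so it is empty exactly when `t ≤ i`; this is the
comparison in `insertWires`. -/
theorem reaches_shiftNat_loop (i : ℕ) (t : ℕ) (d s₁ s₃ s₄ s₆ s₇ : List Bool) :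
    (loop 5 (branch 0 (pop 5) (seq (pop 0) (pop 5)) (seq (pop 0) (seq (push true 4)
      (branch 2 skip skip (seq (pop 2) (push true 6))))))).Reaches
      (Store.ofList [encodeNat i ++ d, s₁, List.replicate t true, s₃, s₄, [true], s₆, s₇])
      (7 * i + 5)
      (Store.ofList [d, s₁, List.replicate (t - i) true, s₃, List.replicate i true ++ s₄, [],
        List.replicate (min i t) true ++ s₆, s₇]) := by
  induction i generalizing t s₄ s₆ with
  | zero =>
    have h : (branch 0 (pop 5) (seq (pop 0) (pop 5)) (seq (pop 0) (seq (push true 4)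
        (branch 2 skip skip (seq (pop 2) (push true 6)))))).Reaches
        (Store.ofList [false :: d, s₁, List.replicate t true, s₃, s₄, [true], s₆, s₇]) 3
        (Store.ofList [d, s₁, List.replicate t true, s₃, s₄, [], s₆, s₇]) :=
      .branch_false rfl (.seq
        (s' := Store.ofList [d, s₁, List.replicate t true, s₃, s₄, [true], s₆, s₇])
        (.pop_ofList (l := [false :: d, s₁, List.replicate t true, s₃, s₄, [true], s₆, s₇])
          (by simp))
        (.pop_ofList (l := [d, s₁, List.replicate t true, s₃, s₄, [true], s₆, s₇]) (by simp)))
    have := (Reaches.loop_step (r := 5) (List.cons_ne_nil _ _) h (Reaches.loop_empty rfl))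
    simpa [encodeNat] using this.mono (by omega)
  | succ i ih =>
    have h : (branch 0 (pop 5) (seq (pop 0) (pop 5)) (seq (pop 0) (seq (push true 4)
        (branch 2 skip skip (seq (pop 2) (push true 6)))))).Reaches
        (Store.ofList [encodeNat (i + 1) ++ d, s₁, List.replicate t true, s₃, s₄, [true], s₆, s₇]) 6
        (Store.ofList [encodeNat i ++ d, s₁, List.replicate (t - 1) true, s₃, true :: s₄, [true],
          List.replicate (min 1 t) true ++ s₆, s₇]) := by
      refine .branch_true rfl (T := 5) (.seq (T := 1) (T' := 4)
        (s' := Store.ofList [encodeNat i ++ d, s₁, List.replicate t true, s₃, s₄, [true], s₆, s₇])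
        (.pop_ofList (l := [encodeNat (i + 1) ++ d, s₁, List.replicate t true, s₃, s₄, [true], s₆,
          s₇]) (by simp)) (.seq (T := 1) (T' := 3)
        (s' := Store.ofList [encodeNat i ++ d, s₁, List.replicate t true, s₃, true :: s₄, [true],
          s₆, s₇])
        (.push_ofList (l := [encodeNat i ++ d, s₁, List.replicate t true, s₃, s₄, [true], s₆, s₇])
          true (by simp)) ?_))
      rcases t with _ | t
      · exact (Reaches.branch_empty rfl (.skip _)).mono (by omega)
      · rw [show min 1 (t + 1) = 1 by omega]
        exact .branch_true rfl (.seq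
          (s' := Store.ofList [encodeNat i ++ d, s₁, List.replicate t true, s₃, true :: s₄, [true],
            s₆, s₇])
          (.pop_ofList (l := [encodeNat i ++ d, s₁, List.replicate (t + 1) true, s₃, true :: s₄,
            [true], s₆, s₇]) (by simp))
          (.push_ofList (l := [encodeNat i ++ d, s₁, List.replicate t true, s₃, true :: s₄, [true],
            s₆, s₇]) true (by simp)))
    have := Reaches.loop_step (List.cons_ne_nil _ _) h
      (ih (t - 1) (true :: s₄) (List.replicate (min 1 t) true ++ s₆))
    rw [← List.append_assoc, ← List.replicate_add, List.append_cons, ← List.replicate_succ',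
      show t - 1 - i = t - (i + 1) by omega,
      show min i (t - 1) + min 1 t = min (i + 1) t by omega] at this
    exact this.mono (by omega)

theorem reaches_shiftNat (t s i : ℕ) (d s₁ s₄ : List Bool) :
    shiftNat.Reaches
      (Store.ofList [encodeNat i ++ d, s₁, List.replicate t true, List.replicate s true, s₄, [],
        [], []])
      (11 * ((i + 1) * (s + 1)))
      (Store.ofList [d, s₁, List.replicate t true, List.replicate s true,
        (encodeNat (insertWires t s i)).reverse ++ s₄, [], [], []]) := by
  have h₁ := Reaches.push_ofList (a := 5) (l := [encodeNat i ++ d, s₁, List.replicate t true,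
    List.replicate s true, s₄, [], [], []]) true (by simp)
  have h₂ := reaches_shiftNat_loop i t d s₁ (List.replicate s true) s₄ [] []
  have h₃ : (branch 2 (seq (moveTwo 3 7 4) (move 7 3)) skip skip).Reaches
      (Store.ofList [d, s₁, List.replicate (t - i) true, List.replicate s true,
        List.replicate i true ++ s₄, [], List.replicate (min i t) true ++ [], []]) (9 * s + 3)
      (Store.ofList [d, s₁, List.replicate (t - i) true, List.replicate s true,
        List.replicate (insertWires t s i) true ++ s₄, [], List.replicate (min i t) true, []]) := by
    rw [List.append_nil]
    by_cases hi : i < t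
    · obtain ⟨m, hm⟩ : ∃ m, t - i = m + 1 := ⟨t - i - 1, by omega⟩
      rw [insertWires, if_pos hi, hm]
      exact (Reaches.branch_true rfl (.skip _)).mono (by omega)
    · rw [insertWires, if_neg hi, show t - i = 0 by omega]
      have m₁ := reaches_moveTwo_ofList (a := 3) (b := 7) (c := 4) (by simp) (by simp) (by simp)
        (l := [d, s₁, List.replicate 0 true, List.replicate s true,
        List.replicate i true ++ s₄, [], List.replicate (min i t) true, []]) (by simp) (by simp)
        (by simp)
      have m₂ := reaches_move_ofList (a := 7) (b := 3) (by simp)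
        (l := [d, s₁, List.replicate 0 true, [],
        List.replicate s true ++ (List.replicate i true ++ s₄), [], List.replicate (min i t) true,
        List.replicate s true]) (by simp) (by simp)
      simp only [List.getD_cons_succ, List.getD_cons_zero, List.set_cons_succ, List.set_cons_zero,
        List.reverse_replicate, List.append_nil, List.length_replicate] at m₁ m₂
      rw [← List.append_assoc, ← List.replicate_add, add_comm s i] at m₂
      rw [← List.append_assoc, ← List.replicate_add, add_comm s i] at m₁
      exact (Reaches.branch_empty rfl (m₁.seq m₂)).mono (by omega)
  have h₄ := reaches_move_ofList (a := 6) (b := 2) (by simp)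
    (l := [d, s₁, List.replicate (t - i) true, List.replicate s true,
        List.replicate (insertWires t s i) true ++ s₄, [], List.replicate (min i t) true, []])
    (by simp) (by simp)
  simp only [List.getD_cons_succ, List.getD_cons_zero, List.set_cons_succ, List.set_cons_zero,
        List.reverse_replicate, List.length_replicate] at h₄
  -- Stacks 2 and 6 together still hold `t` units, so moving stack 6 back restores the threshold for
  -- the next number.
  rw [← List.replicate_add, show min i t + (t - i) = t by omega] at h₄
  have h₅ := Reaches.push_ofList (a := 4) (l := [d, s₁, List.replicate t true,
    List.replicate s true, List.replicate (insertWires t s i) true ++ s₄, [], [], []]) false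
    (by simp)
  rw [show (encodeNat (insertWires t s i)).reverse ++ s₄ =
    false :: (List.replicate (insertWires t s i) true ++ s₄) by simp [encodeNat]]
  refine (h₁.seq (h₂.seq (h₃.seq (h₄.seq h₅)))).mono ?_
  have : min i t ≤ i := min_le_left _ _
  nlinarith [Nat.zero_le (i * s)]

/-- Copy the opcode on top of stack `0` to stack `4` and continue with the corresponding program. -/
def readOpcode : List StackProg → StackProg
  | [] => skip
  | c :: l => branch 0 skip (seq (pop 0) (seq (push false 4) c))
      (seq (pop 0) (seq (push true 4) (readOpcode l)))

theorem reaches_readOpcode (l : List StackProg) (k : ℕ) (c : StackProg) (hk : l[k]? = some c)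
    (d s₁ s₂ s₃ s₄ : List Bool) (s' : Store) (T : ℕ)
    (hc : c.Reaches (Store.ofList [d, s₁, s₂, s₃, (encodeNat k).reverse ++ s₄, [], [], []]) T s') :
    (readOpcode l).Reaches (Store.ofList [encodeNat k ++ d, s₁, s₂, s₃, s₄, [], [], []])
      (3 * (k + 1) + T) s' := by
  induction k generalizing l s₄ with
  | zero =>
    obtain ⟨c', l, rfl⟩ := List.exists_cons_of_ne_nil (l := l) (by rintro rfl; simp at hk)
    obtain rfl : c' = c := by simpa using hk
    have h₁ := Reaches.pop_ofList (a := 0) (l := [false :: d, s₁, s₂, s₃, s₄, [], [], []])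
      (by simp)
    have h₂ := Reaches.push_ofList (a := 4) (l := [d, s₁, s₂, s₃, s₄, [], [], []]) false (by simp)
    exact (Reaches.branch_false rfl (h₁.seq (h₂.seq hc))).mono (by omega)
  | succ k ih =>
    obtain ⟨c', l, rfl⟩ := List.exists_cons_of_ne_nil (l := l) (by rintro rfl; simp at hk)
    have h₁ := Reaches.pop_ofList (a := 0)
      (l := [encodeNat (k + 1) ++ d, s₁, s₂, s₃, s₄, [], [], []]) (by simp)
    have h₂ := Reaches.push_ofList (a := 4)
      (l := [encodeNat k ++ d, s₁, s₂, s₃, s₄, [], [], []]) true (by simp)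
    have h₃ := ih l (by simpa using hk) (true :: s₄) (by
      rwa [show (encodeNat k).reverse ++ true :: s₄ = (encodeNat (k + 1)).reverse ++ s₄ by
        simp only [encodeNat, List.reverse_append, List.reverse_replicate, List.append_assoc]
        rw [List.append_cons, ← List.replicate_succ']])
    exact (Reaches.branch_true rfl (h₁.seq (h₂.seq h₃))).mono (by omega)

/-- Copy the gate on top of stack `0` to stack `4`, inserting wires. -/
def shiftGate : StackProg :=
  readOpcode [shiftNat, shiftNat, shiftNat, seq shiftNat shiftNat,
    seq shiftNat (seq shiftNat shiftNat)]

theorem reaches_shiftGate (t s : ℕ) (g : Gate) (d s₁ s₄ : List Bool) :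
    shiftGate.Reaches
      (Store.ofList [g.encode ++ d, s₁, List.replicate t true, List.replicate s true, s₄, [],
        [], []])
      (11 * (g.encode.length * (s + 1)))
      (Store.ofList [d, s₁, List.replicate t true, List.replicate s true,
        (g.map (insertWires t s)).encode.reverse ++ s₄, [], [], []]) := by
  have hs := reaches_shiftNat t s
  cases g with
  | had i =>
    simp only [Gate.encode, Gate.map, List.append_assoc, List.reverse_append]
    refine (reaches_readOpcode _ 0 _ rfl _ _ _ _ _ _ _ (hs i d s₁ _)).mono ?_
    simp [encodeNat]; nlinarith
  | phase i =>
    simp only [Gate.encode, Gate.map, List.append_assoc, List.reverse_append]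
    refine (reaches_readOpcode _ 1 _ rfl _ _ _ _ _ _ _ (hs i d s₁ _)).mono ?_
    simp [encodeNat]; nlinarith
  | not i =>
    simp only [Gate.encode, Gate.map, List.append_assoc, List.reverse_append]
    refine (reaches_readOpcode _ 2 _ rfl _ _ _ _ _ _ _ (hs i d s₁ _)).mono ?_
    simp [encodeNat]; nlinarith
  | cnot c i =>
    simp only [Gate.encode, Gate.map, List.append_assoc, List.reverse_append]
    refine (reaches_readOpcode _ 3 _ rfl _ _ _ _ _ _ _
      ((hs c _ s₁ _).seq (hs i d s₁ _))).mono ?_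
    simp [encodeNat]; nlinarith
  | toffoli c c' i =>
    simp only [Gate.encode, Gate.map, List.append_assoc, List.reverse_append]
    refine (reaches_readOpcode _ 4 _ rfl _ _ _ _ _ _ _
      ((hs c _ s₁ _).seq ((hs c' _ s₁ _).seq (hs i d s₁ _)))).mono ?_
    simp [encodeNat]; nlinarith

theorem reaches_loop_shiftGate (t s : ℕ) (G : List Gate) (s₁ s₄ : List Bool) :
    (loop 0 shiftGate).Reaches
      (Store.ofList [G.flatMap Gate.encode, s₁, List.replicate t true, List.replicate s true, s₄,
        [], [], []])
      (12 * ((G.flatMap Gate.encode).length * (s + 1)) + 1)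
      (Store.ofList [[], s₁, List.replicate t true, List.replicate s true,
        ((G.map (Gate.map (insertWires t s))).flatMap Gate.encode).reverse ++ s₄, [], [], []]) := by
  induction G generalizing s₄ with
  | nil => exact (Reaches.loop_empty rfl).mono (by omega)
  | cons g G ih =>
    -- Every iteration consumes at least one bit; this pays for the loop test and explains the
    -- constant 12 in place of 11.
    have hg : 1 ≤ g.encode.length := by cases g <;> simp [Gate.encode, encodeNat]
    simp only [List.flatMap_cons, List.map_cons, List.reverse_append, List.append_assoc,
      List.length_append]
    refine (Reaches.loop_step ?_ (reaches_shiftGate t s g _ s₁ s₄) (ih _)).mono ?_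
    · intro h
      have : (g.encode ++ G.flatMap Gate.encode).length = 0 := by
        rw [show g.encode ++ G.flatMap Gate.encode = [] from h]; rfl
      simp at this
      simp [this] at hg
    · nlinarith

end StackProg

/-! ### Polynomial-time operations on circuit descriptions. -/

theorem PolyTimeLength.encodeNat {f : List Bool → ℕ} (hf : PolyTimeLength f) :
    PolyTime fun x => encodeNat (f x) :=
  hf.append (.const [false])

theorem PolyTimeLength.add {f g : List Bool → ℕ} (hf : PolyTimeLength f) (hg : PolyTimeLength g) :
    PolyTimeLength fun x => f x + g x := by
  simpa only [PolyTimeLength, List.replicate_add] using PolyTime.append hf hg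

theorem PolyTimeLength.const (n : ℕ) : PolyTimeLength fun _ => n := PolyTime.const _

/-- The unary header is self-delimiting, so it can be split off. Applied to `QCircuit.encode`, this
recovers the width, and the companion lemma below recovers the list of gates. -/
theorem PolyTimeLength.of_encodeNat_append {f : List Bool → ℕ} {d : List Bool → List Bool}
    (h : PolyTime fun x => _root_.encodeNat (f x) ++ d x) : PolyTimeLength f := by
  refine h.trans (.seq readNat (move 2 1)) (8 * Polynomial.X + 7) fun x => ?_
  rw [inputStore_eq_ofList _ 7]
  refine ⟨_, ((reaches_readNat (f x) (d x) [] [] [] [] [] []).seq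
    (reaches_move_ofList (by simp) (by simp) (by simp))).mono ?_, ?_⟩
  · simp [_root_.encodeNat]; omega
  · simp [Store.ofList]

theorem PolyTime.of_encodeNat_append {f : List Bool → ℕ} {d : List Bool → List Bool}
    (h : PolyTime fun x => encodeNat (f x) ++ d x) : PolyTime d := by
  refine h.trans (.seq readNat (.seq (move 0 3) (move 3 1))) (8 * Polynomial.X + 8) fun x => ?_
  rw [inputStore_eq_ofList _ 7]
  refine ⟨_, ((reaches_readNat (f x) (d x) [] [] [] [] [] []).seq
    ((reaches_move_ofList (a := 0) (b := 3) (by simp) (by simp) (by simp)).seq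
    (reaches_move_ofList (by simp) (by simp) (by simp)))).mono ?_, ?_⟩
  · simp [encodeNat]; omega
  · simp [Store.ofList]

theorem PolyTime.map_insertWires {t s : List Bool → ℕ} {G : List Bool → List Gate}
    (ht : PolyTimeLength t) (hs : PolyTimeLength s)
    (hG : PolyTime fun x => (G x).flatMap Gate.encode) :
    PolyTime fun x => ((G x).map (Gate.map (insertWires (t x) (s x)))).flatMap Gate.encode := by
  -- `s` precedes `t` because `readNat` always delivers to stack 2: `s` is moved on to stack 3
  -- before `t` arrives. The new gates accumulate in reverse on stack 4, and the last move
  -- straightens them.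
  refine (hs.encodeNat.append (ht.encodeNat.append hG)).trans
    (.seq readNat (.seq (move 2 3) (.seq readNat (.seq (loop 0 shiftGate) (move 4 1)))))
    (100 * (Polynomial.X + 1) ^ 2) fun x => ?_
  rw [inputStore_eq_ofList _ 7]
  have h₁ := reaches_readNat (s x) (encodeNat (t x) ++ (G x).flatMap Gate.encode) [] [] [] [] [] []
  have h₂ := reaches_move_ofList (a := 2) (b := 3) (by simp) (l := [encodeNat (t x) ++
    (G x).flatMap Gate.encode, [], List.replicate (s x) true ++ [], [], [], [], [], []])
    (by simp) (by simp)
  have h₃ := reaches_readNat (t x) ((G x).flatMap Gate.encode) [] []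
    (List.replicate (s x) true) [] [] []
  have h₄ := reaches_loop_shiftGate (t x) (s x) (G x) [] []
  simp only [List.getD_cons_succ, List.getD_cons_zero, List.set_cons_succ, List.set_cons_zero,
    List.reverse_replicate, List.length_replicate, List.append_nil] at h₁ h₂ h₃ h₄
  refine ⟨_, (h₁.seq (h₂.seq (h₃.seq (h₄.seq (reaches_move_ofList (by simp) (by simp)
    (by simp)))))).mono ?_, ?_⟩
  · have hlen : (((G x).map (Gate.map (insertWires (t x) (s x)))).flatMap Gate.encode).length ≤
        12 * (((G x).flatMap Gate.encode).length * (s x + 1)) + 1 := by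
      obtain ⟨T, hT, hr⟩ := h₄
      have := hr.length_le 4
      simp only [Store.ofList, List.getD_cons_succ, List.getD_cons_zero, List.length_reverse,
        List.length_nil] at this
      omega
    simp only [List.getD_cons_succ, List.getD_cons_zero, List.length_reverse, encodeNat,
      List.length_append, List.length_replicate, List.length_singleton, Polynomial.eval_mul,
      Polynomial.eval_pow, Polynomial.eval_add, Polynomial.eval_X, Polynomial.eval_one,
      Polynomial.eval_ofNat]
    nlinarith
  · simp [Store.ofList]

/-! ### Operators on a part of the wires and partial traces -/

section Embed

set_option linter.unusedSectionVars false

variable {α β γ : Type}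

open Classical in
/-- The operator `A` on the wires `f`, tensored with the identity on the other wires. -/
noncomputable def embedOp (f : α → β) (A : Matrix (α → Bool) (α → Bool) ℂ) :
    Matrix (β → Bool) (β → Bool) ℂ :=
  Matrix.of fun y z => if ∀ j ∉ Set.range f, y j = z j then A (y ∘ f) (z ∘ f) else 0

open Classical in
/-- The partial trace onto the wires `f`. -/
noncomputable def reduceOp [Fintype β] [DecidableEq β] (f : α → β)
    (ρ : Matrix (β → Bool) (β → Bool) ℂ) : Matrix (α → Bool) (α → Bool) ℂ :=
  Matrix.of fun a b => ∑ y, ∑ z,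
    if y ∘ f = a ∧ z ∘ f = b ∧ ∀ j ∉ Set.range f, y j = z j then ρ y z else 0

/-- The matrix elements of `ρ` between basis states that are not zero on the wires `A` vanish. -/
def FreshOn (A : Set β) (ρ : Matrix (β → Bool) (β → Bool) ℂ) : Prop :=
  ∀ y z, ρ y z ≠ 0 → ∀ j ∈ A, y j = false ∧ z j = false

/-- Functoriality of the embedding; by duality it yields functoriality of the partial trace. -/
theorem embedOp_embedOp {g : β → γ} (hg : Function.Injective g) (f : α → β)
    (A : Matrix (α → Bool) (α → Bool) ℂ) :
    embedOp g (embedOp f A) = embedOp (g ∘ f) A := by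
  classical
  ext y z
  simp only [embedOp, Matrix.of_apply]
  have : (∀ j ∉ Set.range (g ∘ f), y j = z j) ↔
      (∀ j ∉ Set.range g, y j = z j) ∧ ∀ j ∉ Set.range f, (y ∘ g) j = (z ∘ g) j := by
    constructor
    · refine fun h => ⟨fun j hj => h j fun ⟨i, hi⟩ => hj ⟨f i, hi⟩, fun j hj => h _ ?_⟩
      rintro ⟨i, hi⟩
      exact hj ⟨i, hg hi⟩
    · rintro ⟨h₁, h₂⟩ j hj
      by_cases hj' : j ∈ Set.range g
      · obtain ⟨i, rfl⟩ := hj'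
        exact h₂ i fun ⟨k, hk⟩ => hj ⟨k, by simp [hk]⟩
      · exact h₁ j hj'
  rw [← ite_and]
  exact (if_congr this rfl rfl).symm

theorem embedOp_conjTranspose (f : α → β) (A : Matrix (α → Bool) (α → Bool) ℂ) :
    (embedOp f A).conjTranspose = embedOp f A.conjTranspose := by
  classical
  ext y z
  simp only [embedOp, Matrix.of_apply, Matrix.conjTranspose_apply]
  rw [apply_ite star, star_zero]
  exact if_congr (forall₂_congr fun j _ => eq_comm) rfl rfl

variable [Fintype α] [Fintype β] [DecidableEq α] [DecidableEq β]

theorem embedOp_mul {f : α → β} (hf : Function.Injective f)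
    (A B : Matrix (α → Bool) (α → Bool) ℂ) :
    embedOp f (A * B) = embedOp f A * embedOp f B := by
  classical
  ext y z
  simp only [embedOp, Matrix.mul_apply, Matrix.of_apply]
  by_cases h : ∀ j ∉ Set.range f, y j = z j
  · rw [if_pos h]
    -- Only intermediate basis states that agree with `y` off the range of `f` contribute to the
    -- product; `e` parametrizes them by their values on the wires `f`.
    let e : (α → Bool) → (β → Bool) := fun u j =>
      if hj : j ∈ Set.range f then u hj.choose else y j
    have he : ∀ u, e u ∘ f = u := fun u => by
      ext i
      have hi : f i ∈ Set.range f := ⟨i, rfl⟩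
      simp only [Function.comp, e, dif_pos hi, hf hi.choose_spec]
    have he' : ∀ u, ∀ j ∉ Set.range f, e u j = y j := fun u j hj => by simp only [e, dif_neg hj]
    refine Finset.sum_of_injOn e (fun u _ v _ huv => by rw [← he u, huv, he]) (by simp) ?_ ?_
    · intro u _ hu
      split_ifs with h₁ h₂
      · refine absurd ⟨u ∘ f, by simp, ?_⟩ hu
        ext j
        by_cases hj : j ∈ Set.range f
        · obtain ⟨i, rfl⟩ := hj
          exact congrFun (he (u ∘ f)) i
        · rw [he' _ j hj, h₁ j hj]
      all_goals simp
    · intro u _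
      rw [he, if_pos fun j hj => (he' u j hj).symm, if_pos fun j hj => (he' u j hj).trans (h j hj)]
  · rw [if_neg h, Finset.sum_eq_zero]
    intro u _
    split_ifs with h₁ h₂
    · exact absurd (fun j hj => (h₁ j hj).trans (h₂ j hj)) h
    all_goals simp

theorem embedOp_one {f : α → β} : embedOp f (1 : Matrix (α → Bool) (α → Bool) ℂ) = 1 := by
  ext y z
  simp only [embedOp, Matrix.of_apply, Matrix.one_apply]
  by_cases h : y = z
  · simp [h]
  · rw [if_neg h]
    split_ifs with h₁ h₂
    · refine absurd (funext fun j => ?_) h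
      by_cases hj : j ∈ Set.range f
      · obtain ⟨i, rfl⟩ := hj
        exact congrFun h₂ i
      · exact h₁ j hj
    all_goals rfl

/-- The partial trace is adjoint to the embedding of operators. As the trace pairing is
nondegenerate, this characterizes `reduceOp`, and its structural properties follow from those of
`embedOp`. -/
theorem trace_mul_reduceOp (f : α → β) (A : Matrix (α → Bool) (α → Bool) ℂ)
    (ρ : Matrix (β → Bool) (β → Bool) ℂ) :
    (A * reduceOp f ρ).trace = (embedOp f A * ρ).trace := by
  classical
  simp only [Matrix.trace, Matrix.diag, Matrix.mul_apply, reduceOp, embedOp, Matrix.of_apply,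
    Finset.mul_sum]
  calc _ = ∑ y, ∑ z, ∑ a, ∑ b, A a b *
        if y ∘ f = b ∧ z ∘ f = a ∧ ∀ j ∉ Set.range f, y j = z j then ρ y z else 0 := by
        rw [Finset.sum_congr rfl fun a _ => Finset.sum_comm, Finset.sum_comm]
        refine Finset.sum_congr rfl fun y _ => ?_
        rw [Finset.sum_congr rfl fun a _ => Finset.sum_comm, Finset.sum_comm]
        congr!
    _ = ∑ y, ∑ z, (if ∀ j ∉ Set.range f, z j = y j then A (z ∘ f) (y ∘ f) else 0) * ρ y z := by
        refine Finset.sum_congr rfl fun y _ => Finset.sum_congr rfl fun z _ => ?_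
        rw [Finset.sum_eq_single (z ∘ f), Finset.sum_eq_single (y ∘ f)]
        · simp [eq_comm]
        · intro b _ hb
          rw [if_neg fun h => hb h.1.symm, mul_zero]
        · simp
        · intro a _ ha
          refine Finset.sum_eq_zero fun b _ => ?_
          rw [if_neg fun h => ha h.2.1.symm, mul_zero]
        · simp
    _ = _ := by
        refine Finset.sum_comm.trans ?_
        congr!

/-- Tested against an operator `A`, both sides become the trace of the embedded `Uᴴ A U` times `ρ`,
by cyclicity and multiplicativity of the embedding. -/
theorem reduceOp_conj {f : α → β} (hf : Function.Injective f)
    (U : Matrix (α → Bool) (α → Bool) ℂ) (ρ : Matrix (β → Bool) (β → Bool) ℂ) :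
    reduceOp f (embedOp f U * ρ * (embedOp f U).conjTranspose) =
      U * reduceOp f ρ * U.conjTranspose := by
  refine Matrix.ext_iff_trace_mul_left.2 fun A => ?_
  rw [trace_mul_reduceOp, ← Matrix.mul_assoc, Matrix.trace_mul_comm, ← Matrix.mul_assoc A,
    Matrix.trace_mul_comm (A * _), ← Matrix.mul_assoc A, ← Matrix.mul_assoc U.conjTranspose,
    trace_mul_reduceOp, embedOp_conjTranspose]
  simp only [embedOp_mul hf, Matrix.mul_assoc]

theorem reduceOp_reduceOp [Fintype γ] [DecidableEq γ] {g : β → γ} (hg : Function.Injective g)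
    (f : α → β) (ρ : Matrix (γ → Bool) (γ → Bool) ℂ) :
    reduceOp f (reduceOp g ρ) = reduceOp (g ∘ f) ρ := by
  refine Matrix.ext_iff_trace_mul_left.2 fun A => ?_
  rw [trace_mul_reduceOp, trace_mul_reduceOp, trace_mul_reduceOp, embedOp_embedOp hg]

/-- An operator on the wires `f` is diagonal on all other wires, hence preserves zeros there. This
certifies that ancillas of later circuits are still unused. -/
theorem FreshOn.conj {f : α → β} {A : Set β} (hA : Disjoint A (Set.range f))
    {ρ : Matrix (β → Bool) (β → Bool) ℂ} (hρ : FreshOn A ρ) (U : Matrix (α → Bool) (α → Bool) ℂ) :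
    FreshOn A (embedOp f U * ρ * (embedOp f U).conjTranspose) := by
  intro y z h j hj
  have hj' : j ∉ Set.range f := Set.disjoint_left.1 hA hj
  have key : ∀ y z, embedOp f U y z ≠ 0 → y j = z j := by
    intro y z h
    by_contra hne
    refine h ?_
    rw [embedOp, Matrix.of_apply, if_neg fun h => hne (h j hj')]
  rw [Matrix.mul_apply] at h
  obtain ⟨z', -, hz'⟩ := Finset.exists_ne_zero_of_sum_ne_zero h
  have h₁ := left_ne_zero_of_mul hz'
  have h₂ := right_ne_zero_of_mul hz'
  rw [Matrix.mul_apply] at h₁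
  obtain ⟨y', -, hy'⟩ := Finset.exists_ne_zero_of_sum_ne_zero h₁
  rw [Matrix.conjTranspose_apply, star_ne_zero] at h₂
  have h₃ := hρ y' z' (right_ne_zero_of_mul hy') j hj
  rw [key y y' (left_ne_zero_of_mul hy'), key z z' h₂]
  exact h₃

theorem FreshOn.reduceOp {f : α → β} {A : Set α} {ρ : Matrix (β → Bool) (β → Bool) ℂ}
    (hρ : FreshOn (f '' A) ρ) : FreshOn A (reduceOp f ρ) := by
  intro a b h j hj
  rw [_root_.reduceOp, Matrix.of_apply] at h
  obtain ⟨y, -, hy⟩ := Finset.exists_ne_zero_of_sum_ne_zero h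
  obtain ⟨z, -, hz⟩ := Finset.exists_ne_zero_of_sum_ne_zero hy
  split_ifs at hz with h'
  · rw [← h'.1, ← h'.2.1]
    exact hρ y z hz _ ⟨j, hj, rfl⟩
  · exact absurd rfl hz

/-- Once basis states are parametrized as pairs of kept and discarded bits, the condition off the
range of `f` forces equal discarded bits. This connects `reduceOp` with concrete formulas such as
`keepFirst`. -/
theorem reduceOp_apply_eq_sum [Fintype γ] {f : α → β} (merge : (α → Bool) → γ → (β → Bool))
    (hbij : Function.Bijective fun p : (α → Bool) × γ => merge p.1 p.2)
    (hf : ∀ a c, merge a c ∘ f = a)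
    (hoff : ∀ a b c d, (∀ j ∉ Set.range f, merge a c j = merge b d j) ↔ c = d)
    (ρ : Matrix (β → Bool) (β → Bool) ℂ) (a b : α → Bool) :
    reduceOp f ρ a b = ∑ c, ρ (merge a c) (merge b c) := by
  classical
  rw [reduceOp, Matrix.of_apply, ← hbij.sum_comp, Fintype.sum_prod_type, Finset.sum_eq_single a]
  · refine Finset.sum_congr rfl fun c _ => ?_
    rw [← hbij.sum_comp, Fintype.sum_prod_type, Finset.sum_eq_single b, Finset.sum_eq_single c]
    · rw [if_pos ⟨hf _ _, hf _ _, (hoff _ _ _ _).2 rfl⟩]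
    · intro d _ hd
      rw [if_neg fun h => hd ((hoff _ _ _ _).1 h.2.2).symm]
    · simp
    · intro b' _ hb'
      refine Finset.sum_eq_zero fun d _ => if_neg fun h => hb' ?_
      rw [← h.2.1, hf]
    · simp
  · intro a' _ ha'
    refine Finset.sum_eq_zero fun c _ => Finset.sum_eq_zero fun z _ => if_neg fun h => ha' ?_
    rw [← h.1, hf]
  · simp

theorem reduceOp_const_apply (j : β) (ρ : Matrix (β → Bool) (β → Bool) ℂ) (b : Bool) :
    reduceOp (fun _ : Fin 1 => j) ρ (fun _ => b) (fun _ => b) =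
      ∑ y, if y j = b then ρ y y else 0 := by
  classical
  rw [reduceOp, Matrix.of_apply]
  refine Finset.sum_congr rfl fun y _ => ?_
  rw [Finset.sum_eq_single y]
  · simp [funext_iff]
  · intro z _ hz
    refine if_neg fun ⟨h₁, h₂, h₃⟩ => hz (funext fun i => ?_)
    by_cases hi : i = j
    · subst hi
      have e₁ := congrFun h₁ 0
      have e₂ := congrFun h₂ 0
      simp only [Function.comp] at e₁ e₂
      rw [e₁, e₂]
    · exact (h₃ i (by simpa using hi)).symm
  · simp

end Embed

/-! ### Renaming the wires of a circuit -/

theorem wire_eq {w : ℕ} (y : Bits w) (i : Fin w) : wire y i = y i := by simp [wire]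

theorem toggle_toggle {w : ℕ} (b : Bool) (i : ℕ) (y : Bits w) : toggle b i (toggle b i y) = y := by
  ext j
  by_cases h : (j : ℕ) = i <;> simp [toggle, h]

theorem wire_toggle_of_ne {w : ℕ} (b : Bool) {i c : ℕ} (h : c ≠ i) (y : Bits w) :
    wire (toggle b i y) c = wire y c := by
  by_cases hc : c < w <;> simp [wire, toggle, h, hc]

theorem ite_eq_ite_ite {δ : Type*} {p q r : Prop} {_ : Decidable p} {_ : Decidable q}
    {_ : Decidable r} (h : p ↔ q ∧ r) (a b : δ) :
    (if p then a else b) = if q then (if r then a else b) else b := by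
  by_cases hq : q <;> by_cases hr : r <;> simp [h, hq, hr]

section Rename

variable {w W : ℕ} {f : ℕ → ℕ} {F : Fin w → Fin W}

theorem wire_comp (hF : ∀ i, (F i : ℕ) = f i) {i : ℕ} (hi : i < w) (y : Bits W) :
    wire y (f i) = wire (y ∘ F) i := by
  have := hF ⟨i, hi⟩
  rw [← this, wire_eq, wire, dif_pos hi]
  rfl

/-- NOT, CNOT and Toffoli are toggles whose bit depends on the control wires, so this splitting
treats all three at once. -/
theorem eq_toggle_iff (hF : ∀ i, (F i : ℕ) = f i) (hinj : Function.Injective F) {i : ℕ}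
    (hi : i < w) (b : Bool) (y z : Bits W) :
    y = toggle b (f i) z ↔
      (∀ j ∉ Set.range F, y j = z j) ∧ y ∘ F = toggle b i (z ∘ F) := by
  have key : ∀ k : Fin w, ((F k : ℕ) = f i ↔ (k : ℕ) = i) := by
    intro k
    rw [← hF ⟨i, hi⟩, ← Fin.ext_iff, hinj.eq_iff, Fin.ext_iff]
  constructor
  · rintro rfl
    refine ⟨fun j hj => ?_, funext fun k => ?_⟩
    · rw [toggle, if_neg]
      intro h
      exact hj ⟨⟨i, hi⟩, Fin.ext ((hF _).trans h.symm)⟩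
    · simp [toggle, key]
  · rintro ⟨h₁, h₂⟩
    ext1 j
    by_cases hj : j ∈ Set.range F
    · obtain ⟨k, rfl⟩ := hj
      have := congrFun h₂ k
      simp only [toggle, Function.comp] at this
      simp only [toggle, key, this]
    · rw [h₁ j hj, toggle, if_neg]
      intro h
      exact hj ⟨⟨i, hi⟩, Fin.ext ((hF _).trans h.symm)⟩

theorem Gate.op_map (hF : ∀ i, (F i : ℕ) = f i) (hinj : Function.Injective F) {g : Gate}
    (hg : g.Valid w) : (g.map f).op W = embedOp F (g.op w) := by
  ext y z
  cases g with
  | had i =>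
    have hg : i < w := hg
    simp only [Gate.map, Gate.op, embedOp, Matrix.of_apply, wire_comp hF hg]
    refine ite_eq_ite_ite ?_ _ _
    have key : ∀ k : Fin w, ((F k : ℕ) = f i ↔ (k : ℕ) = i) := by
      intro k
      rw [← hF ⟨i, hg⟩, ← Fin.ext_iff, hinj.eq_iff, Fin.ext_iff]
    constructor
    · refine fun h => ⟨fun j hj => h j fun hj' => ?_, fun k hk => h _ (by rwa [Ne, key])⟩
      exact hj ⟨⟨i, hg⟩, Fin.ext ((hF _).trans hj'.symm)⟩
    · rintro ⟨h₁, h₂⟩ j hj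
      by_cases hj' : j ∈ Set.range F
      · obtain ⟨k, rfl⟩ := hj'
        exact h₂ k (by rwa [Ne, ← key])
      · exact h₁ j hj'
  | phase i =>
    have hg : i < w := hg
    have h₁ := wire_comp hF hg y
    -- Toggling by `false` is the identity, so the case of a diagonal matrix is covered as well.
    have h₂ := eq_toggle_iff hF hinj hg false y z
    have ht : ∀ {w : ℕ} (i : ℕ) (z : Bits w), toggle false i z = z := by
      intro w i z; ext j; simp [toggle]
    simp only [ht] at h₂
    simp only [Gate.map, Gate.op, embedOp, Matrix.of_apply, Matrix.diagonal_apply, h₁]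
    exact ite_eq_ite_ite h₂ _ _
  | not i =>
    simp only [Gate.map, Gate.op, embedOp, Matrix.of_apply]
    exact ite_eq_ite_ite (eq_toggle_iff hF hinj hg _ _ _) _ _
  | cnot c i =>
    simp only [Gate.map, Gate.op, embedOp, Matrix.of_apply]
    rw [wire_comp hF hg.1]
    exact ite_eq_ite_ite (eq_toggle_iff hF hinj hg.2.1 _ _ _) _ _
  | toffoli c d i =>
    simp only [Gate.map, Gate.op, embedOp, Matrix.of_apply]
    rw [wire_comp hF hg.1, wire_comp hF hg.2.1]
    exact ite_eq_ite_ite (eq_toggle_iff hF hinj hg.2.2.1 _ _ _) _ _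

end Rename

/-- The operator of a list of gates on `w` wires. -/
noncomputable def circuitOp (w : ℕ) (G : List Gate) : Op w :=
  G.foldl (fun U g => g.op w * U) 1

theorem QCircuit.unitary_eq (C : QCircuit) : C.unitary = circuitOp C.width C.gates := rfl

theorem circuitOp_nil (w : ℕ) : circuitOp w [] = 1 := rfl

theorem circuitOp_append (w : ℕ) (G H : List Gate) :
    circuitOp w (G ++ H) = circuitOp w H * circuitOp w G := by
  have key : ∀ (H : List Gate) (A : Op w),
      H.foldl (fun U g => g.op w * U) A = H.foldl (fun U g => g.op w * U) 1 * A := by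
    intro H
    induction H with
    | nil => simp
    | cons g H ih =>
      intro A
      rw [List.foldl_cons, List.foldl_cons, ih, ih (g.op w * 1), Matrix.mul_one, Matrix.mul_assoc]
  rw [circuitOp, List.foldl_append, key]
  rfl

theorem circuitOp_singleton (w : ℕ) (g : Gate) : circuitOp w [g] = g.op w := by
  simp [circuitOp]

theorem circuitOp_cons (w : ℕ) (g : Gate) (G : List Gate) :
    circuitOp w (g :: G) = circuitOp w G * g.op w := by
  rw [← List.singleton_append, circuitOp_append, circuitOp_singleton]

theorem circuitOp_map {w W : ℕ} {f : ℕ → ℕ} {F : Fin w → Fin W} (hF : ∀ i, (F i : ℕ) = f i)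
    (hinj : Function.Injective F) {G : List Gate} (hG : ∀ g ∈ G, g.Valid w) :
    circuitOp W (G.map (Gate.map f)) = embedOp F (circuitOp w G) := by
  induction G with
  | nil => rw [List.map_nil, circuitOp_nil, circuitOp_nil, embedOp_one]
  | cons g G ih =>
    rw [List.map_cons, circuitOp_cons, circuitOp_cons, embedOp_mul hinj,
      Gate.op_map hF hinj (hG g (by simp)), ih fun g hg => hG g (by simp [hg])]

theorem Gate.Valid.map {w W : ℕ} {f : ℕ → ℕ} (hf : Function.Injective f)
    (hfw : ∀ i < w, f i < W) {g : Gate} (hg : g.Valid w) : (g.map f).Valid W := by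
  cases g <;> simp_all [Gate.Valid, Gate.map, hf.eq_iff]

/-! ### Gates are unitary -/

theorem conjTranspose_mul_self_of_involutive {ι : Type} [Fintype ι] [DecidableEq ι] {π : ι → ι}
    (hπ : Function.Involutive π) {P : Matrix ι ι ℂ} (hP : ∀ y z, P y z = if y = π z then 1 else 0) :
    P.conjTranspose * P = 1 := by
  ext a b
  simp only [Matrix.mul_apply, Matrix.conjTranspose_apply, hP, Matrix.one_apply]
  simp [hπ.injective.eq_iff, eq_comm]

theorem conj_apply_of_involutive {ι : Type} [Fintype ι] [DecidableEq ι] {π : ι → ι}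
    (hπ : Function.Involutive π) {P : Matrix ι ι ℂ} (hP : ∀ y z, P y z = if y = π z then 1 else 0)
    (ρ : Matrix ι ι ℂ) (y z : ι) : (P * ρ * P.conjTranspose) y z = ρ (π y) (π z) := by
  have h : ∀ y z, (y = π z ↔ z = π y) := fun y z =>
    ⟨fun h => by rw [h, hπ], fun h => by rw [h, hπ]⟩
  simp only [Matrix.mul_apply, Matrix.conjTranspose_apply, hP, h y, h z]
  simp

theorem involutive_toggle_not {w : ℕ} (i : ℕ) :
    Function.Involutive (toggle (w := w) true i) := toggle_toggle _ _

theorem involutive_toggle_cnot {w c i : ℕ} (h : c ≠ i) :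
    Function.Involutive fun z : Bits w => toggle (wire z c) i z := fun z => by
  simp only [wire_toggle_of_ne _ h, toggle_toggle]

theorem involutive_toggle_toffoli {w c d i : ℕ} (hc : c ≠ i) (hd : d ≠ i) :
    Function.Involutive fun z : Bits w => toggle (wire z c && wire z d) i z := fun z => by
  simp only [wire_toggle_of_ne _ hc, wire_toggle_of_ne _ hd, toggle_toggle]

theorem had_conjTranspose_mul_self :
    ((Gate.had 0).op 1).conjTranspose * (Gate.had 0).op 1 = 1 := by
  have h2 : ((Real.sqrt 2 : ℝ) : ℂ) * (Real.sqrt 2 : ℝ) = 2 := by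
    rw [← Complex.ofReal_mul, Real.mul_self_sqrt (by norm_num)]; norm_num
  have h0 : ((Real.sqrt 2 : ℝ) : ℂ) ≠ 0 := by simp
  ext a b
  rw [Matrix.mul_apply, ← (Equiv.funUnique (Fin 1) Bool).symm.sum_comp, Fintype.sum_bool]
  have key : ∀ u v : Bool, (fun _ => u : Bits 1) = (fun _ => v) ↔ u = v := fun u v =>
    ⟨fun h => congrFun h 0, fun h => by rw [h]⟩
  obtain ⟨u, rfl⟩ : ∃ u, a = fun _ => u := ⟨a 0, by ext i; rw [Subsingleton.elim i 0]⟩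
  obtain ⟨v, rfl⟩ : ∃ v, b = fun _ => v := ⟨b 0, by ext i; rw [Subsingleton.elim i 0]⟩
  rw [Matrix.one_apply, if_congr (key u v) rfl rfl]
  simp only [Gate.op, Matrix.conjTranspose_apply, Matrix.of_apply, wire]
  cases u <;> cases v <;> simp [Equiv.funUnique, uniqueElim, ← sq] <;> field_simp <;>
    simp [sq, h2] <;> norm_num

theorem Gate.conjTranspose_mul_self {w : ℕ} {g : Gate} (hg : g.Valid w) :
    (g.op w).conjTranspose * g.op w = 1 := by
  cases g with
  | had i =>
    have hg : i < w := hg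
    -- A Hadamard gate on any wire is the embedding of the one on a single wire, where unitarity is
    -- a computation with `2 × 2` matrices.
    let F : Fin 1 → Fin w := fun _ => ⟨i, hg⟩
    have hF : Function.Injective F := fun a b _ => Subsingleton.elim a b
    have := Gate.op_map (f := fun _ => i) (F := F) (fun _ => rfl) hF
      (g := .had 0) (show (0 : ℕ) < 1 by decide)
    rw [show Gate.had i = (Gate.had 0).map fun _ => i from rfl, this, embedOp_conjTranspose,
      ← embedOp_mul hF, had_conjTranspose_mul_self, embedOp_one]
  | phase i =>
    rw [Gate.op, Matrix.diagonal_conjTranspose, Matrix.diagonal_mul_diagonal,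
      ← Matrix.diagonal_one]
    congr 1
    ext y
    by_cases h : wire y i <;> simp [h]
  | not i => exact conjTranspose_mul_self_of_involutive (involutive_toggle_not i) fun _ _ => rfl
  | cnot c i =>
    exact conjTranspose_mul_self_of_involutive (involutive_toggle_cnot hg.2.2) fun _ _ => rfl
  | toffoli c d i =>
    exact conjTranspose_mul_self_of_involutive
      (involutive_toggle_toffoli hg.2.2.2.2.1 hg.2.2.2.2.2) fun _ _ => rfl

theorem circuitOp_conjTranspose_mul_self {w : ℕ} {G : List Gate} (hG : ∀ g ∈ G, g.Valid w) :
    (circuitOp w G).conjTranspose * circuitOp w G = 1 := by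
  induction G with
  | nil => simp [circuitOp_nil]
  | cons g G ih =>
    rw [circuitOp_cons, Matrix.conjTranspose_mul, Matrix.mul_assoc,
      ← Matrix.mul_assoc _ (circuitOp w G), ih fun g hg => hG g (by simp [hg]), Matrix.one_mul,
      Gate.conjTranspose_mul_self (hG g (by simp))]

/-! ### Circuits acting on a part of the wires -/

/-- The `b`, `b'` matrix element of an operator, as an operator on the first wires. -/
def blockOp {α β : Type} (Y : Matrix (α ⊕ β → Bool) (α ⊕ β → Bool) ℂ) (b b' : β → Bool) :
    Matrix (α → Bool) (α → Bool) ℂ :=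
  Matrix.of fun u v => Y (Sum.elim u b) (Sum.elim v b')

theorem glue_bijective {m w : ℕ} (h : m ≤ w) :
    Function.Bijective fun p : Bits m × Bits (w - m) => (glue p.1 p.2 : Bits w) := by
  constructor
  · rintro ⟨a, e⟩ ⟨b, e'⟩ hab
    refine Prod.ext (funext fun i => ?_) (funext fun i => ?_)
    · have := congrFun hab (Fin.castLE h i)
      simpa [glue] using this
    · have := congrFun hab ⟨m + i, by omega⟩
      simpa [glue] using this
  · intro y
    refine ⟨(fun i => y (Fin.castLE h i), fun i => y ⟨m + i, by omega⟩), funext fun j => ?_⟩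
    by_cases hj : (j : ℕ) < m
    · simp [glue, hj, Fin.castLE]
    · simp only [glue, hj, dif_neg, not_false_eq_true]
      congr 1
      ext
      simp only
      omega

theorem glue_comp_castLE {m w : ℕ} (h : m ≤ w) (a : Bits m) (e : Bits (w - m)) :
    glue a e ∘ Fin.castLE h = a := by
  ext i; simp [glue]

theorem glue_off_iff {m w : ℕ} (h : m ≤ w) (a b : Bits m) (e e' : Bits (w - m)) :
    (∀ j : Fin w, j ∉ Set.range (Fin.castLE h) → glue a e j = glue b e' j) ↔ e = e' := by
  have hr : ∀ j : Fin w, j ∉ Set.range (Fin.castLE h) ↔ ¬ (j : ℕ) < m := by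
    intro j
    rw [not_iff_not]
    exact ⟨by rintro ⟨i, rfl⟩; exact i.2, fun hj => ⟨⟨j, hj⟩, rfl⟩⟩
  constructor
  · refine fun H => funext fun i => ?_
    have := H ⟨m + i, by omega⟩ (by rw [hr]; simp)
    simpa [glue] using this
  · rintro rfl j hj
    rw [hr] at hj
    simp [glue, hj]

theorem keepFirst_eq_reduceOp {m w : ℕ} (h : m ≤ w) (ρ : Op w) :
    keepFirst m ρ = reduceOp (Fin.castLE h) ρ := by
  ext a b
  rw [reduceOp_apply_eq_sum (fun a e => glue a e) (glue_bijective h) (glue_comp_castLE h)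
    (glue_off_iff h)]
  rfl

theorem append_castAdd_natAdd {m k : ℕ} {δ : Type} (y : Fin (m + k) → δ) :
    Fin.append (fun i => y (Fin.castAdd k i)) (fun i => y (Fin.natAdd m i)) = y :=
  Fin.append_castAdd_natAdd

theorem reduceOp_append_inl_inr {m w k : ℕ} (h : m ≤ w)
    (Y : Matrix (Fin w ⊕ Fin k → Bool) (Fin w ⊕ Fin k → Bool) ℂ) (y z : Bits (m + k)) :
    reduceOp (Fin.append (fun i => Sum.inl (Fin.castLE h i)) Sum.inr) Y y z =
      keepFirst m (blockOp Y (fun i => y (Fin.natAdd m i)) fun i => z (Fin.natAdd m i))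
        (fun i => y (Fin.castAdd k i)) fun i => z (Fin.castAdd k i) := by
  rw [reduceOp_apply_eq_sum (γ := Bits (w - m)) (fun y e =>
    Sum.elim (glue (fun i => y (Fin.castAdd k i)) e) fun i => y (Fin.natAdd m i))]
  · rfl
  · constructor
    · rintro ⟨a, e⟩ ⟨b, e'⟩ hab
      have h₁ := fun i => congrFun hab (Sum.inl i)
      have h₂ := fun i => congrFun hab (Sum.inr i)
      have h₃ := (glue_bijective h).1 (a₁ := (fun i => a (Fin.castAdd k i), e))
        (a₂ := (fun i => b (Fin.castAdd k i), e')) (funext h₁)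
      simp only [Prod.mk.injEq, Sum.elim_inr] at h₃ h₂
      refine Prod.ext (show a = b from ?_) h₃.2
      rw [← append_castAdd_natAdd a, ← append_castAdd_natAdd b, h₃.1]
      exact congrArg _ (funext h₂)
    · intro s
      obtain ⟨⟨a, e⟩, hae⟩ := (glue_bijective h).2 (s ∘ Sum.inl)
      refine ⟨(Fin.append a (s ∘ Sum.inr), e), ?_⟩
      rw [← Sum.elim_comp_inl_inr s, ← hae]
      simp
      rfl
  · intro a c
    rw [← append_castAdd_natAdd (Sum.elim _ _ ∘ _), ← append_castAdd_natAdd a]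
    congr 1
    · ext i; simp [glue]
    · ext i; simp
  · intro a b c d
    rw [← glue_off_iff h (fun i => a (Fin.castAdd k i)) (fun i => b (Fin.castAdd k i)) c d]
    constructor
    · intro H j hj
      refine H (Sum.inl j) ?_
      rintro ⟨i, hi⟩
      induction i using Fin.addCases with
      | left i => exact hj ⟨i, by simpa using hi⟩
      | right i => simp at hi
    · rintro H (j | j) hj
      · exact H j fun ⟨i, hi⟩ => hj ⟨Fin.castAdd k i, by simp [hi]⟩
      · exact absurd ⟨Fin.natAdd m j, by simp⟩ hj

theorem sum_elim_bijective {α β : Type} :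
    Function.Bijective fun p : (α → Bool) × (β → Bool) => Sum.elim p.1 p.2 :=
  (Equiv.sumArrowEquivProdArrow α β Bool).symm.bijective

/-- An operator `U ⊗ 1` does not mix the blocks indexed by the second register, so it conjugates
each block by `U`. -/
theorem blockOp_conj {α β : Type} [Fintype α] [DecidableEq α] [Fintype β] [DecidableEq β]
    (U : Matrix (α → Bool) (α → Bool) ℂ) (R : Matrix (α ⊕ β → Bool) (α ⊕ β → Bool) ℂ)
    (b b' : β → Bool) :
    blockOp (embedOp Sum.inl U * R * (embedOp Sum.inl U).conjTranspose) b b' =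
      U * blockOp R b b' * U.conjTranspose := by
  have key : ∀ u b v c, embedOp (Sum.inl : α → α ⊕ β) U (Sum.elim u b) (Sum.elim v c) =
      if c = b then U u v else 0 := by
    intro u b v c
    rw [embedOp, Matrix.of_apply]
    by_cases h : c = b
    · subst h
      rw [if_pos rfl, if_pos]
      · rfl
      · rintro (j | j) hj
        · simp at hj
        · rfl
    · rw [if_neg h, if_neg]
      exact fun H => h (funext fun i => (H (Sum.inr i) (by simp)).symm)
  ext u v
  simp only [blockOp, Matrix.of_apply, Matrix.mul_apply, Matrix.conjTranspose_apply]
  rw [← sum_elim_bijective.sum_comp, Fintype.sum_prod_type]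
  refine Finset.sum_congr rfl fun v' _ => ?_
  rw [Finset.sum_eq_single b']
  · rw [key, if_pos rfl, ← sum_elim_bijective.sum_comp, Fintype.sum_prod_type]
    congr 1
    refine Finset.sum_congr rfl fun u' _ => ?_
    rw [Finset.sum_eq_single b]
    · rw [key, if_pos rfl]
    · intro c _ hc
      rw [key, if_neg hc, zero_mul]
    · simp
  · intro c _ hc
    rw [key, if_neg hc, star_zero, mul_zero]
  · simp

/-- If the last wires are certainly zero, discarding them loses nothing. Thus wires found in a fresh
state inside a large register can replace newly added ancillas. -/
theorem addAncillas_keepFirst {n w : ℕ} (h : n ≤ w) {M : Op w}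
    (hM : FreshOn {i : Fin w | n ≤ (i : ℕ)} M) : addAncillas w (keepFirst n M) = M := by
  ext y z
  rw [addAncillas, Matrix.of_apply]
  by_cases H : ∀ j : Fin w, n ≤ (j : ℕ) → y j = false ∧ z j = false
  · rw [if_pos H, keepFirst, Matrix.of_apply]
    have hglue : ∀ y : Bits w, (∀ j : Fin w, n ≤ (j : ℕ) → y j = false) →
        glue (fun i : Fin n => wire y i) (fun _ => false) = y := by
      intro y hy
      ext j
      by_cases hj : (j : ℕ) < n
      · simp [glue, hj, wire]
      · simp [glue, hj, hy j (by omega)]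
    rw [Finset.sum_eq_single fun _ => false]
    · rw [hglue y fun j hj => (H j hj).1, hglue z fun j hj => (H j hj).2]
    · intro e _ he
      by_contra hne
      refine he (funext fun i => ?_)
      have := (hM _ _ hne ⟨n + i, by omega⟩ (by simp)).1
      simpa [glue] using this
    · simp
  · rw [if_neg H]
    by_contra hne
    exact H fun j hj => hM y z (Ne.symm hne) j hj

/-- Running a circuit on some wires of a large register, the wires `h` being left alone. -/
theorem reduceOp_conj_circuit {W n m k : ℕ} (C : QCircuit) (hn : n ≤ C.width) (hm : m ≤ C.width)
    (f : Fin C.width → Fin W) (h : Fin k → Fin W) (hinj : Function.Injective (Sum.elim f h))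
    {ρ : Op W} (hρ : FreshOn (f '' {i | n ≤ (i : ℕ)}) ρ) :
    reduceOp (Fin.append (f ∘ Fin.castLE hm) h)
        (embedOp f C.unitary * ρ * (embedOp f C.unitary).conjTranspose) =
      joinOp (tensorId (C.channel n m) k (splitOp
        (reduceOp (Fin.append (f ∘ Fin.castLE hn) h) ρ))) := by
  have happ : ∀ {m} (hm : m ≤ C.width), Fin.append (f ∘ Fin.castLE hm) h =
      Sum.elim f h ∘ Fin.append (fun i => Sum.inl (Fin.castLE hm i)) Sum.inr := by
    intro m hm
    ext i
    induction i using Fin.addCases <;> simp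
  have hf : embedOp f C.unitary = embedOp (Sum.elim f h) (embedOp Sum.inl C.unitary) := by
    rw [embedOp_embedOp hinj, Sum.elim_comp_inl]
  -- All wires except those of `C` and of `h` are traced out first. On what remains, `C` acts on the
  -- left summand, and the claim can be checked block by block.
  rw [happ hm, happ hn, ← reduceOp_reduceOp hinj, ← reduceOp_reduceOp hinj, hf, reduceOp_conj hinj]
  have hfresh : FreshOn (Sum.inl '' {i : Fin C.width | n ≤ (i : ℕ)})
      (reduceOp (Sum.elim f h) ρ) := by
    refine FreshOn.reduceOp ?_
    rwa [Set.image_image]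
  generalize reduceOp (Sum.elim f h) ρ = R at hfresh
  ext y z
  rw [reduceOp_append_inl_inr, blockOp_conj]
  simp only [joinOp, tensorId, splitOp, Matrix.of_apply, QCircuit.channel]
  have : (Matrix.of fun a b => reduceOp (Fin.append (fun i => Sum.inl (Fin.castLE hn i)) Sum.inr) R
      (Fin.append a fun i => y (Fin.natAdd m i)) (Fin.append b fun i => z (Fin.natAdd m i))) =
      keepFirst n (blockOp R (fun i => y (Fin.natAdd m i)) fun i => z (Fin.natAdd m i)) := by
    ext a b
    rw [Matrix.of_apply, reduceOp_append_inl_inr]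
    simp
  rw [this, addAncillas_keepFirst hn]
  intro u v huv j hj
  simpa using hfresh _ _ huv (Sum.inl j) ⟨j, hj, rfl⟩

theorem joinOp_tensorId_zero_splitOp {n m : ℕ} (Φ : Op n → Op m) (ρ : Op (n + 0)) :
    joinOp (tensorId Φ 0 (splitOp ρ)) = Φ ρ := by
  ext y z
  simp only [joinOp, tensorId, splitOp, Matrix.of_apply]
  congr 1
  ext a b
  rw [Matrix.of_apply]
  congr 1 <;>
  · ext i
    induction i using Fin.addCases with
    | left i => exact Fin.append_left _ _ i
    | right i => exact i.elim0

/-! ### States -/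

theorem trace_reduceOp {α β : Type} [Fintype α] [DecidableEq α] [Fintype β] [DecidableEq β]
    {f : α → β} (ρ : Matrix (β → Bool) (β → Bool) ℂ) :
    (reduceOp f ρ).trace = ρ.trace := by
  have := trace_mul_reduceOp f 1 ρ
  rwa [Matrix.one_mul, embedOp_one, Matrix.one_mul] at this

theorem freshOn_addAncillas {n w : ℕ} (ρ : Op n) :
    FreshOn {i : Fin w | n ≤ (i : ℕ)} (addAncillas w ρ) := by
  intro y z h j hj
  rw [addAncillas, Matrix.of_apply] at h
  by_contra hne
  exact h (if_neg fun H => hne (H j hj))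

theorem keepFirst_addAncillas {n w : ℕ} (h : n ≤ w) (ρ : Op n) :
    keepFirst n (addAncillas w ρ) = ρ := by
  ext a b
  rw [keepFirst, Matrix.of_apply, Finset.sum_eq_single fun _ => false]
  · rw [addAncillas, Matrix.of_apply, if_pos]
    · have : ∀ (a : Bits n) e, (fun i : Fin n => wire (glue a e : Bits w) i) = a := by
        intro a e; ext i
        have : (i : ℕ) < w := by omega
        simp [wire, glue, this]
      rw [this, this]
    · intro j hj
      simp [glue, not_lt.2 hj]
  · intro e _ he
    by_contra hne
    refine he (funext fun i => ?_)
    have := (freshOn_addAncillas ρ _ _ hne ⟨n + i, by omega⟩ (by simp)).1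
    simpa [glue] using this
  · simp

theorem trace_addAncillas {n w : ℕ} (h : n ≤ w) (ρ : Op n) :
    (addAncillas w ρ).trace = ρ.trace := by
  rw [← trace_reduceOp (f := Fin.castLE h), ← keepFirst_eq_reduceOp, keepFirst_addAncillas h]

/-- Validity matters here: it makes the gates unitary, and it ensures that ancillas and discarded
wires are genuine. -/
theorem trace_channel {C : QCircuit} {n m : ℕ} (hC : C.Valid n m) (ρ : Op n) :
    (C.channel n m ρ).trace = ρ.trace := by
  rw [QCircuit.channel, keepFirst_eq_reduceOp hC.2.1, trace_reduceOp, Matrix.trace_mul_comm,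
    ← Matrix.mul_assoc, QCircuit.unitary_eq, circuitOp_conjTranspose_mul_self hC.2.2,
    Matrix.one_mul, trace_addAncillas hC.1]

theorem posSemidef_addAncillas {n w : ℕ} {ρ : Op n} (hρ : ρ.PosSemidef) :
    (addAncillas w ρ).PosSemidef := by
  -- `D` is the projection onto zero ancillas; adding ancillas is pulling back along the first
  -- wires, then compressing by `D`.
  let D : Op w := Matrix.diagonal fun y => if ∀ j : Fin w, n ≤ (j : ℕ) → y j = false then 1 else 0
  have : addAncillas w ρ = D * ρ.submatrix (fun y i => wire y i) (fun y i => wire y i) *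
      D.conjTranspose := by
    ext y z
    simp only [D, Matrix.diagonal_conjTranspose, Matrix.mul_diagonal, Matrix.diagonal_mul,
      Matrix.submatrix_apply, addAncillas, Matrix.of_apply, Pi.star_apply]
    by_cases hy : ∀ j : Fin w, n ≤ (j : ℕ) → y j = false
    · by_cases hz : ∀ j : Fin w, n ≤ (j : ℕ) → z j = false
      · rw [if_pos hy, if_pos hz, if_pos fun j hj => ⟨hy j hj, hz j hj⟩]; simp
      · rw [if_neg hz, if_neg fun H => hz fun j hj => (H j hj).2]; simp
    · rw [if_neg hy, if_neg fun H => hy fun j hj => (H j hj).1]; simp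
  rw [this]
  exact (hρ.submatrix _).mul_mul_conjTranspose_same D

theorem posSemidef_keepFirst {m w : ℕ} {ρ : Op w} (hρ : ρ.PosSemidef) :
    (keepFirst m ρ).PosSemidef := by
  have : keepFirst m ρ = ∑ e, ρ.submatrix (fun a => glue a e) fun a => glue a e := by
    ext a b
    rw [keepFirst, Matrix.of_apply, Matrix.sum_apply]
    rfl
  rw [this]
  exact Matrix.posSemidef_sum _ fun e _ => hρ.submatrix _

theorem IsState.channel {C : QCircuit} {n m : ℕ} (hC : C.Valid n m) {ρ : Op n} (hρ : IsState ρ) :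
    IsState (C.channel n m ρ) :=
  ⟨posSemidef_keepFirst ((posSemidef_addAncillas hρ.1).mul_mul_conjTranspose_same _),
    (trace_channel hC ρ).trans hρ.2⟩

theorem IsState.splitOp {n k : ℕ} {ρ : Op (n + k)} (hρ : IsState ρ) :
    IsState (splitOp ρ : Op₂ n k) := by
  refine ⟨hρ.1.submatrix fun a : Bits n × Bits k => Fin.append a.1 a.2, ?_⟩
  rw [← hρ.2]
  exact (Fin.appendEquiv n k).sum_comp fun y => ρ y y

theorem isState_one : IsState (1 : Op 0) := ⟨.one, by simp [Matrix.trace_one]⟩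

theorem channel_smul (C : QCircuit) (n m : ℕ) (c : ℂ) (ρ : Op n) :
    C.channel n m (c • ρ) = c • C.channel n m ρ := by
  have h : addAncillas C.width (c • ρ) = c • addAncillas C.width ρ := by
    ext y z; simp [addAncillas]
  ext a b
  simp [QCircuit.channel, h, keepFirst, Finset.mul_sum]

/-! ### The circuit of an interaction -/

/-- The circuit that runs `A`, which prepares `p + k` qubits, then `S` on the first `p` of them, and
finally `B` on the `r` output qubits of `S` and the remaining `k` qubits; the first output qubit is
copied to wire `0`. -/
def QCircuit.interact (p r k : ℕ) (A S B : QCircuit) : QCircuit where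
  -- Wire 0 is reserved for the result. From wire 1 on lies the block of `S`, sharing its first `p`
  -- wires with `A` and its first `r` wires with `B`; then come `p + r` idle wires, the `k` private
  -- qubits, the other wires of `A`, and the ancillas of `B`. The idle wires make every offset a
  -- sum, so that no subtraction has to be computed.
  width := 1 + A.width + B.width + p + S.width
  gates :=
    (A.gates.map (Gate.map (insertWires 0 1))).map (Gate.map (insertWires (1 + p) (r + S.width))) ++
    (S.gates.map (Gate.map (insertWires 0 1)) ++
    ((B.gates.map (Gate.map (insertWires 0 1)) ++ [Gate.cnot 1 0]).map
      (Gate.map (insertWires (1 + r) (p + S.width)))).map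
        (Gate.map (insertWires (1 + r + p + S.width + k) A.width)))

theorem insertWires_injective (t s : ℕ) : Function.Injective (insertWires t s) := by
  intro a b h
  simp only [insertWires] at h
  split_ifs at h <;> omega

theorem Gate.map_map (f g : ℕ → ℕ) : Gate.map g ∘ Gate.map f = Gate.map (g ∘ f) := by
  ext1 a; cases a <;> rfl

theorem eq_one_of_trace_eq_one {ι : Type} [Fintype ι] [DecidableEq ι] [Unique ι]
    {X : Matrix ι ι ℂ} (h : X.trace = 1) : X = 1 := by
  ext a b
  rw [Subsingleton.elim a default, Subsingleton.elim b default, Matrix.one_apply_eq, ← h]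
  simp [Matrix.trace]

/-! ### Correctness of the circuit of an interaction. -/

theorem probOne_keepFirst {w : ℕ} (h : 0 < w) (ρ : Op w) :
    probOne (keepFirst 1 ρ) = (∑ y : Bits w, if y ⟨0, h⟩ = true then ρ y y else 0).re := by
  rw [probOne, keepFirst_eq_reduceOp (Nat.succ_le_of_lt h),
    show Fin.castLE (Nat.succ_le_of_lt h) = fun _ => ⟨0, h⟩ by
      ext i; simp, reduceOp_const_apply]

/-- Copying wire `o` to a fresh wire `0` does not change the output distribution. -/
theorem probOne_keepFirst_cnot {w : ℕ} (h : 0 < w) (o : Fin w) (ho : (o : ℕ) ≠ 0) {ρ : Op w}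
    (hρ : FreshOn {⟨0, h⟩} ρ) :
    probOne (keepFirst 1 ((Gate.cnot o 0).op w * ρ * ((Gate.cnot o 0).op w).conjTranspose)) =
      probOne (reduceOp (fun _ : Fin 1 => o) ρ) := by
  rw [probOne_keepFirst h, probOne, reduceOp_const_apply]
  have hπ := involutive_toggle_cnot (w := w) ho
  congr 1
  rw [← hπ.bijective.sum_comp]
  refine Finset.sum_congr rfl fun y _ => ?_
  rw [conj_apply_of_involutive hπ (P := (Gate.cnot o 0).op w) (fun _ _ => rfl) ρ]
  simp only [hπ y]
  by_cases h0 : ρ y y = 0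
  · simp [h0]
  · have := (hρ y y h0 ⟨0, h⟩ rfl).1
    refine if_congr ?_ rfl rfl
    simp [toggle, this, wire_eq]

/-- The CNOT is attached once wire 0 has been inserted. The later insertions happen above wire 0, so
its target stays put while its control follows the first wire of `B`, wherever that ends up (in the
private register if `r = 0`). -/
theorem gates_interact (p r k : ℕ) (A S B : QCircuit) :
    (A.interact p r k S B).gates =
      A.gates.map (Gate.map (insertWires (1 + p) (r + S.width) ∘ insertWires 0 1)) ++
      (S.gates.map (Gate.map (insertWires 0 1)) ++
      (B.gates.map (Gate.map (insertWires (1 + r + p + S.width + k) A.width ∘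
        insertWires (1 + r) (p + S.width) ∘ insertWires 0 1)) ++
      [Gate.cnot ((insertWires (1 + r + p + S.width + k) A.width ∘
        insertWires (1 + r) (p + S.width) ∘ insertWires 0 1) 0) 0])) := by
  simp only [QCircuit.interact, List.map_append, List.map_map, List.map_cons, List.map_nil,
    Gate.map_map]
  congr 4
  simp [Gate.map, insertWires]

theorem valid_interact {p r k : ℕ} {A S B : QCircuit} (hA : A.Valid 0 (p + k)) (hS : S.Valid p r)
    (hB : B.Valid (r + k) 1) : (A.interact p r k S B).Valid 0 1 := by
  obtain ⟨-, hA₁, hA₂⟩ := hA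
  obtain ⟨hS₀, hS₁, hS₂⟩ := hS
  obtain ⟨hB₀, hB₁, hB₂⟩ := hB
  refine ⟨Nat.zero_le _, by simp only [QCircuit.interact]; omega, ?_⟩
  intro g hg
  rw [gates_interact] at hg
  simp only [List.mem_append, List.mem_map, List.mem_singleton] at hg
  simp only [QCircuit.interact]
  rcases hg with ⟨g, hg, rfl⟩ | ⟨g, hg, rfl⟩ | ⟨g, hg, rfl⟩ | rfl
  · refine (hA₂ g hg).map ((insertWires_injective _ _).comp (insertWires_injective _ _)) ?_
    intro i hi
    simp only [insertWires, Function.comp]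
    split_ifs <;> omega
  · refine (hS₂ g hg).map (insertWires_injective _ _) ?_
    intro i hi
    simp only [insertWires]
    split_ifs <;> omega
  · refine (hB₂ g hg).map ((insertWires_injective _ _).comp
      ((insertWires_injective _ _).comp (insertWires_injective _ _))) ?_
    intro i hi
    simp only [insertWires, Function.comp]
    split_ifs <;> omega
  · simp only [Gate.Valid, insertWires, Function.comp]
    split_ifs <;> omega

/-- Each of the three circuits is run inside the common register by `reduceOp_conj_circuit`. The
layout makes the outputs of one circuit the inputs of the next, and keeps the ancillas of `S` and
`B` and wire 0 disjoint from everything used before them. -/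
theorem probOne_interact {p r k : ℕ} {A S B : QCircuit} (hA : A.Valid 0 (p + k)) (hS : S.Valid p r)
    (hB : B.Valid (r + k) 1) :
    probOne ((A.interact p r k S B).channel 0 1 1) =
      probOne (B.channel (r + k) 1 (joinOp (tensorId (S.channel p r) k
        (splitOp (A.channel 0 (p + k) 1))))) := by
  obtain ⟨hA₀, hA₁, hA₂⟩ := hA
  obtain ⟨hS₀, hS₁, hS₂⟩ := hS
  obtain ⟨hB₀, hB₁, hB₂⟩ := hB
  obtain ⟨W, hW⟩ : ∃ W, W = (A.interact p r k S B).width := ⟨_, rfl⟩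
  have hW' : W = 1 + A.width + B.width + p + S.width := hW
  obtain ⟨f₁, hf₁⟩ : ∃ f, f = insertWires (1 + p) (r + S.width) ∘ insertWires 0 1 := ⟨_, rfl⟩
  obtain ⟨f₂, hf₂⟩ : ∃ f, f = insertWires 0 1 := ⟨_, rfl⟩
  obtain ⟨f₃, hf₃⟩ : ∃ f, f = insertWires (1 + r + p + S.width + k) A.width ∘
    insertWires (1 + r) (p + S.width) ∘ insertWires 0 1 := ⟨_, rfl⟩
  have v₁ : ∀ i, f₁ i = if i < p then 1 + i else 1 + i + r + S.width := by
    intro i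
    simp only [hf₁, insertWires, Function.comp]
    split_ifs <;> omega
  have v₂ : ∀ i, f₂ i = 1 + i := by
    intro i
    simp only [hf₂, insertWires]
    split_ifs <;> omega
  have v₃ : ∀ i, f₃ i = if i < r then 1 + i else if i < r + k then 1 + i + p + S.width else
      1 + i + p + S.width + A.width := by
    intro i
    simp only [hf₃, insertWires, Function.comp]
    split_ifs <;> omega
  have b₁ : ∀ i : Fin A.width, f₁ i < W := fun i => by rw [v₁]; split_ifs <;> omega
  have b₂ : ∀ i : Fin S.width, f₂ i < W := fun i => by rw [v₂]; omega
  have b₃ : ∀ i : Fin B.width, f₃ i < W := fun i => by rw [v₃]; split_ifs <;> omega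
  let F₁ : Fin A.width → Fin W := fun i => ⟨f₁ i, b₁ i⟩
  let F₂ : Fin S.width → Fin W := fun i => ⟨f₂ i, b₂ i⟩
  let F₃ : Fin B.width → Fin W := fun i => ⟨f₃ i, b₃ i⟩
  have e₁ : ∀ i, (F₁ i : ℕ) = if (i : ℕ) < p then 1 + (i : ℕ) else 1 + i + r + S.width :=
    fun i => v₁ i
  have e₂ : ∀ i, (F₂ i : ℕ) = 1 + i := fun i => v₂ i
  have e₃ : ∀ i, (F₃ i : ℕ) = if (i : ℕ) < r then 1 + (i : ℕ) else if (i : ℕ) < r + k then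
      1 + i + p + S.width else 1 + i + p + S.width + A.width := fun i => v₃ i
  have i₁ : Function.Injective F₁ := fun a b h => by
    have := congrArg Fin.val h
    rw [e₁, e₁] at this
    ext; split_ifs at this <;> omega
  have i₂ : Function.Injective F₂ := fun a b h => by
    have := congrArg Fin.val h
    rw [e₂, e₂] at this
    ext; omega
  have i₃ : Function.Injective F₃ := fun a b h => by
    have := congrArg Fin.val h
    rw [e₃, e₃] at this
    ext; split_ifs at this <;> omega
  have hU : circuitOp W (A.interact p r k S B).gates = (Gate.cnot (f₃ 0) 0).op W *
      embedOp F₃ B.unitary * embedOp F₂ S.unitary * embedOp F₁ A.unitary := by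
    rw [gates_interact, ← hf₁, ← hf₃, ← hf₂, circuitOp_append, circuitOp_append, circuitOp_append,
      circuitOp_singleton, circuitOp_map (F := F₁) (fun _ => rfl) i₁ hA₂,
      circuitOp_map (F := F₂) (fun _ => rfl) i₂ hS₂, circuitOp_map (F := F₃) (fun _ => rfl) i₃ hB₂]
    simp only [QCircuit.unitary_eq, Matrix.mul_assoc]
  obtain ⟨ρ₀, hρ₀⟩ : ∃ ρ₀ : Op W, ρ₀ = addAncillas W (1 : Op 0) := ⟨_, rfl⟩
  obtain ⟨ρ₁, hρ₁⟩ : ∃ ρ₁, ρ₁ = embedOp F₁ A.unitary * ρ₀ * (embedOp F₁ A.unitary).conjTranspose :=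
    ⟨_, rfl⟩
  obtain ⟨ρ₂, hρ₂⟩ : ∃ ρ₂, ρ₂ = embedOp F₂ S.unitary * ρ₁ * (embedOp F₂ S.unitary).conjTranspose :=
    ⟨_, rfl⟩
  obtain ⟨ρ₃, hρ₃⟩ : ∃ ρ₃, ρ₃ = embedOp F₃ B.unitary * ρ₂ * (embedOp F₃ B.unitary).conjTranspose :=
    ⟨_, rfl⟩
  have fresh₀ : ∀ T, FreshOn T ρ₀ := fun T y z h j _ => by
    rw [hρ₀] at h
    exact freshOn_addAncillas _ y z h j (Nat.zero_le _)
  have fresh₁ : ∀ {T}, Disjoint T (Set.range F₁) → FreshOn T ρ₁ := fun h => by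
    rw [hρ₁]
    exact (fresh₀ _).conj h _
  have fresh₂ : ∀ {T}, Disjoint T (Set.range F₁) → Disjoint T (Set.range F₂) → FreshOn T ρ₂ :=
    fun h h' => by
      rw [hρ₂]
      exact (fresh₁ h).conj h' _
  have fresh₃ : ∀ {T}, Disjoint T (Set.range F₁) → Disjoint T (Set.range F₂) →
      Disjoint T (Set.range F₃) → FreshOn T ρ₃ := fun h h' h'' => by
    rw [hρ₃]
    exact (fresh₂ h h').conj h'' _
  have elim_inj : ∀ {w : ℕ} {F : Fin w → Fin W}, Function.Injective F →
      Function.Injective (Sum.elim F (Fin.elim0 : Fin 0 → Fin W)) := fun hF =>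
    hF.sumElim (fun a => a.elim0) fun _ b => b.elim0
  have append_elim0 : ∀ {w : ℕ} (F : Fin w → Fin W),
      Fin.append F (Fin.elim0 : Fin 0 → Fin W) = F := fun F => by
    ext i
    induction i using Fin.addCases with
    | left i => rw [Fin.append_left]; rfl
    | right i => exact i.elim0
  have s₁ : reduceOp (F₁ ∘ Fin.castLE hA₁) ρ₁ = A.channel 0 (p + k) 1 := by
    have := reduceOp_conj_circuit A hA₀ hA₁ F₁ Fin.elim0 (elim_inj i₁) (fresh₀ _)
    rw [joinOp_tensorId_zero_splitOp, ← hρ₁, append_elim0] at this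
    rw [this]
    congr 1
    -- The input has no qubits, so it is a `1 × 1` matrix and is determined by its trace.
    refine eq_one_of_trace_eq_one (ι := Bits 0) ((trace_reduceOp _).trans ?_)
    rw [hρ₀, trace_addAncillas (Nat.zero_le _)]
    exact isState_one.2
  have s₂ := reduceOp_conj_circuit S hS₀ hS₁ F₂ (fun i : Fin k => F₁ ⟨p + i, by omega⟩)
    (i₂.sumElim (fun a b h => by have := i₁ h; simp only [Fin.mk.injEq] at this; ext; omega)
      fun a b h => by
        have := congrArg Fin.val h
        rw [e₂, e₁] at this
        split_ifs at this <;> simp only at * <;> omega) (ρ := ρ₁) (fresh₁ (by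
          rw [Set.disjoint_left]
          rintro _ ⟨a, ha, rfl⟩ ⟨b, h⟩
          have := congrArg Fin.val h
          rw [e₂, e₁] at this
          simp only [Set.mem_ofPred_eq] at ha
          split_ifs at this <;> omega))
  -- The inputs of `S` followed by the private qubits are the output wires of `A`, in order.
  rw [← hρ₂, show Fin.append (F₂ ∘ Fin.castLE hS₀) (fun i : Fin k => F₁ ⟨p + i, by omega⟩) =
    F₁ ∘ Fin.castLE hA₁ by
      ext i
      induction i using Fin.addCases with
      | left i => rw [Fin.append_left, Function.comp, Function.comp, e₂, e₁]; simp
      | right i => rw [Fin.append_right]; rfl, s₁] at s₂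
  have s₃ := reduceOp_conj_circuit B hB₀ hB₁ F₃ Fin.elim0 (elim_inj i₃) (ρ := ρ₂) (fresh₂ (by
      rw [Set.disjoint_left]
      rintro _ ⟨a, ha, rfl⟩ ⟨b, h⟩
      have := congrArg Fin.val h
      rw [e₃, e₁] at this
      simp only [Set.mem_ofPred_eq] at ha
      split_ifs at this <;> omega) (by
      rw [Set.disjoint_left]
      rintro _ ⟨a, ha, rfl⟩ ⟨b, h⟩
      have := congrArg Fin.val h
      rw [e₃, e₂] at this
      simp only [Set.mem_ofPred_eq] at ha
      split_ifs at this <;> omega))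
  rw [← hρ₃, append_elim0, append_elim0, joinOp_tensorId_zero_splitOp,
    show F₃ ∘ Fin.castLE hB₀ = Fin.append (F₂ ∘ Fin.castLE hS₁)
      (fun i : Fin k => F₁ ⟨p + i, by omega⟩) by
      ext i
      induction i using Fin.addCases with
      | left i => rw [Fin.append_left, Function.comp, Function.comp, e₂, e₃]; simp
      | right i =>
        rw [Fin.append_right, Function.comp, e₃, e₁]
        simp
        omega, s₂] at s₃
  rw [← s₃]
  have hout : (Gate.cnot (f₃ 0) 0) = Gate.cnot ((F₃ ⟨0, hB₁⟩ : Fin W) : ℕ) 0 := rfl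
  have := probOne_keepFirst_cnot (w := W) (by omega) (F₃ ⟨0, hB₁⟩)
    (by rw [e₃]; split_ifs <;> omega) (ρ := ρ₃) (by
      have key : ∀ {w : ℕ} (F : Fin w → Fin W), (∀ i, (F i : ℕ) ≠ 0) →
          Disjoint {(⟨0, by omega⟩ : Fin W)} (Set.range F) := fun F hF => by
        rw [Set.disjoint_singleton_left]
        rintro ⟨i, hi⟩
        exact hF i (congrArg Fin.val hi)
      refine fresh₃ (key _ fun i => ?_) (key _ fun i => ?_) (key _ fun i => ?_)
      · rw [e₁]; split_ifs <;> omega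
      · rw [e₂]; omega
      · rw [e₃]; split_ifs <;> omega)
  rw [← hout] at this
  rw [show F₃ ∘ Fin.castLE hB₁ = fun _ => F₃ ⟨0, hB₁⟩ by
      ext i; simp [Subsingleton.elim i 0]; rfl,
    ← this, QCircuit.channel, QCircuit.unitary_eq]
  subst hW
  rw [hU, hρ₃, hρ₂, hρ₁, hρ₀]
  simp only [Matrix.conjTranspose_mul, Matrix.mul_assoc]

/-- Wires are counted in unary and every gate has a nonempty code, so circuits with polynomial-time
descriptions have polynomial size. This admits the verifier's second circuit as a distinguisher. -/
theorem QCircuit.size_le_length_encode (C : QCircuit) : C.size ≤ C.encode.length := by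
  have h : ∀ G : List Gate, G.length ≤ (G.flatMap Gate.encode).length := by
    intro G
    induction G with
    | nil => simp
    | cons g G ih =>
      have : 1 ≤ g.encode.length := by cases g <;> simp [Gate.encode, encodeNat]
      simp only [List.length_cons, List.flatMap_cons, List.length_append]
      omega
  have := h C.gates
  simp only [QCircuit.size, QCircuit.encode, encodeNat, List.length_append, List.length_replicate]
  omega

/-- All insertion points and offsets are sums of lengths and widths, so repeated use of
`PolyTime.map_insertWires` and concatenation suffices. -/
theorem polyTime_interact {p r k : List Bool → ℕ} {A S B : List Bool → QCircuit}
    (hp : PolyTimeLength p) (hr : PolyTimeLength r) (hk : PolyTimeLength k)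
    (hA : PolyTime fun x => (A x).encode) (hS : PolyTime fun x => (S x).encode)
    (hB : PolyTime fun x => (B x).encode) :
    PolyTime fun x => ((A x).interact (p x) (r x) (k x) (S x) (B x)).encode := by
  have wA : PolyTimeLength fun x => (A x).width := .of_encodeNat_append hA
  have wS : PolyTimeLength fun x => (S x).width := .of_encodeNat_append hS
  have wB : PolyTimeLength fun x => (B x).width := .of_encodeNat_append hB
  have gA : PolyTime fun x => (A x).gates.flatMap Gate.encode := .of_encodeNat_append hA
  have gS : PolyTime fun x => (S x).gates.flatMap Gate.encode := .of_encodeNat_append hS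
  have gB : PolyTime fun x => (B x).gates.flatMap Gate.encode := .of_encodeNat_append hB
  have c₀ := PolyTimeLength.const 0
  have c₁ := PolyTimeLength.const 1
  have hB' : PolyTime fun x =>
      ((B x).gates.map (Gate.map (insertWires 0 1)) ++ [Gate.cnot 1 0]).flatMap Gate.encode := by
    simp only [List.flatMap_append]
    exact (PolyTime.map_insertWires c₀ c₁ gB).append (.const _)
  have hfirst := PolyTime.map_insertWires (c₁.add hp) (hr.add wS)
    (PolyTime.map_insertWires c₀ c₁ gA)
  have hsecond := PolyTime.map_insertWires ((((c₁.add hr).add hp).add wS).add hk) wA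
    (PolyTime.map_insertWires (c₁.add hr) (hp.add wS) hB')
  have hW := ((((c₁.add wA).add wB).add hp).add wS).encodeNat
  simp only [QCircuit.encode, QCircuit.interact, List.flatMap_append] at *
  exact hW.append (hfirst.append ((PolyTime.map_insertWires c₀ c₁ gS).append hsecond))

/-! ### Acceptance probabilities of quantum polynomial-time algorithms -/

/-- Some quantum polynomial-time algorithm accepts every `x` with probability `a x`. -/
def IsAcceptProb (a : List Bool → ℝ) : Prop :=
  ∃ C : List Bool → QCircuit, QPT (fun _ => 0) (fun _ => 1) C ∧
    ∀ x, probOne ((C x).channel 0 1 1) = a x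

theorem isAcceptProb_interact {p r k : List Bool → ℕ} {A S B : List Bool → QCircuit}
    (hp : PolyTimeLength p) (hr : PolyTimeLength r) (hk : PolyTimeLength k)
    (hA : QPT (fun _ => 0) (fun x => p x + k x) A) (hS : QPT p r S)
    (hB : QPT (fun x => r x + k x) (fun _ => 1) B) :
    IsAcceptProb fun x => probOne ((B x).channel (r x + k x) 1 (joinOp
      (tensorId ((S x).channel (p x) (r x)) (k x)
        (splitOp ((A x).channel 0 (p x + k x) 1))))) :=
  ⟨fun x => (A x).interact (p x) (r x) (k x) (S x) (B x),
    ⟨polyTime_interact hp hr hk hA.1 hS.1 hB.1, fun x => valid_interact (hA.2 x) (hS.2 x) (hB.2 x)⟩,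
    fun x => probOne_interact (hA.2 x) (hS.2 x) (hB.2 x)⟩

/-! ### Boolean combinations of independent runs. -/

/-- A circuit that computes the negated conjunction of its two input bits. -/
def nandCircuit : QCircuit :=
  ⟨3, [.toffoli 0 1 2, .not 2, .cnot 2 0, .cnot 0 2, .cnot 2 0]⟩

theorem valid_nandCircuit : nandCircuit.Valid 2 1 := by
  simp [nandCircuit, QCircuit.Valid, Gate.Valid]

theorem addAncillas_three_apply (σ : Op 2) (a b c : Bool) :
    addAncillas 3 σ ![a, b, c] ![a, b, c] = if c = false then σ ![a, b] ![a, b] else 0 := by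
  rw [addAncillas, Matrix.of_apply]
  have : (fun i : Fin 2 => wire ![a, b, c] i) = ![a, b] := by
    revert a b c; decide
  rw [this]
  refine if_congr ?_ rfl rfl
  revert a b c; decide

theorem sum_bits_two {M : Type*} [AddCommMonoid M] (F : Bits 2 → M) :
    ∑ e, F e = ∑ a : Bool, ∑ b : Bool, F ![a, b] := by
  rw [← (finTwoArrowEquiv Bool).symm.sum_comp, Fintype.sum_prod_type]
  rfl

theorem probOne_nandCircuit (σ : Op 2) :
    probOne (nandCircuit.channel 2 1 σ) =
      (∑ a : Bool, ∑ b : Bool, if (a && b) = false then σ ![a, b] ![a, b] else 0).re := by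
  -- The gates permute basis states, so the output distribution is found by pulling basis states
  -- back. The three CNOTs swap wires 0 and 2, which brings the result to the output wire.
  have hπ : ∀ a b : Bool,
      (fun z : Bits 3 => toggle (wire z 0 && wire z 1) 2 z) (toggle true 2
      ((fun z : Bits 3 => toggle (wire z 2) 0 z) ((fun z : Bits 3 => toggle (wire z 0) 2 z)
      ((fun z : Bits 3 => toggle (wire z 2) 0 z)
        (glue (fun _ : Fin 1 => true) (![a, b] : Bits (3 - 1))))))) = ![b, a, b && a] := by
    decide
  have hU : circuitOp 3 nandCircuit.gates * addAncillas 3 σ *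
      (circuitOp 3 nandCircuit.gates).conjTranspose =
      (Gate.cnot 2 0).op 3 * ((Gate.cnot 0 2).op 3 * ((Gate.cnot 2 0).op 3 * ((Gate.not 2).op 3 *
      ((Gate.toffoli 0 1 2).op 3 * addAncillas 3 σ * ((Gate.toffoli 0 1 2).op 3).conjTranspose) *
      ((Gate.not 2).op 3).conjTranspose) * ((Gate.cnot 2 0).op 3).conjTranspose) *
      ((Gate.cnot 0 2).op 3).conjTranspose) * ((Gate.cnot 2 0).op 3).conjTranspose := by
    simp only [nandCircuit, circuitOp_cons, circuitOp_nil, Matrix.one_mul, Matrix.conjTranspose_mul,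
      Matrix.mul_assoc]
  change (keepFirst 1 (circuitOp 3 nandCircuit.gates * addAncillas 3 σ *
    (circuitOp 3 nandCircuit.gates).conjTranspose) (fun _ => true) fun _ => true).re = _
  rw [hU, keepFirst, Matrix.of_apply]
  simp only [conj_apply_of_involutive (P := (Gate.cnot 2 0).op 3)
      (involutive_toggle_cnot (by decide)) (fun _ _ => rfl),
    conj_apply_of_involutive (P := (Gate.cnot 0 2).op 3)
      (involutive_toggle_cnot (by decide)) (fun _ _ => rfl),
    conj_apply_of_involutive (P := (Gate.not 2).op 3)
      (involutive_toggle_not 2) (fun _ _ => rfl),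
    conj_apply_of_involutive (P := (Gate.toffoli 0 1 2).op 3)
      (involutive_toggle_toffoli (by decide) (by decide)) (fun _ _ => rfl)]
  congr 1
  refine (sum_bits_two _).trans ?_
  rw [Finset.sum_comm]
  refine Finset.sum_congr rfl fun b _ => Finset.sum_congr rfl fun a _ => ?_
  exact (congrArg₂ (addAncillas 3 σ) (hπ a b) (hπ a b)).trans
    (addAncillas_three_apply σ b a (b && a))

theorem IsState.apply_eq_probOne {ρ : Op 1} (h : IsState ρ) :
    ρ (fun _ => true) (fun _ => true) = (probOne ρ : ℂ) := by
  have := h.1.isHermitian.apply (fun _ => true) (fun _ => true)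
  exact (Complex.conj_eq_iff_re.1 this).symm

theorem sum_bits_one {M : Type*} [AddCommMonoid M] (F : Bits 1 → M) :
    ∑ e, F e = F (fun _ => true) + F (fun _ => false) := by
  rw [← (Equiv.funUnique (Fin 1) Bool).symm.sum_comp, Fintype.sum_bool]
  rfl

/-- With an empty message the input of the NAND circuit is a product state, so its diagonal entries
are products of probabilities. -/
theorem probOne_nandCircuit_interact {A S : QCircuit} (hA : A.Valid 0 1) (hS : S.Valid 0 1) :
    probOne (nandCircuit.channel (1 + 1) 1 (joinOp (tensorId (S.channel 0 1) 1
      (splitOp (A.channel 0 (0 + 1) 1))))) =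
      1 - probOne (A.channel 0 1 1) * probOne (S.channel 0 1 1) := by
  have stA := isState_one.channel hA
  have stS := isState_one.channel hS
  have h : ∀ a b : Bool, joinOp (tensorId (S.channel 0 1) 1
      (splitOp (A.channel 0 (0 + 1) 1))) ![a, b] ![a, b] =
      A.channel 0 1 1 (fun _ => b) (fun _ => b) * S.channel 0 1 1 (fun _ => a) (fun _ => a) := by
    intro a b
    rw [← smul_eq_mul, ← Matrix.smul_apply, ← channel_smul]
    simp only [joinOp, tensorId, splitOp, Matrix.of_apply]
    have h₁ : (fun i : Fin 1 => (![a, b] : Bits (1 + 1)) (Fin.castAdd 1 i)) = fun _ => a := by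
      ext i; rw [Subsingleton.elim i 0]; rfl
    have h₂ : (fun i : Fin 1 => (![a, b] : Bits (1 + 1)) (Fin.natAdd 1 i)) = fun _ => b := by
      ext i; rw [Subsingleton.elim i 0]; rfl
    have h₃ : ∀ y : Bits 0, (Fin.append y (fun _ => b : Bits 1) : Bits (0 + 1)) = fun _ => b := by
      intro y; ext i
      induction i using Fin.addCases with
      | left i => exact i.elim0
      | right i => exact Fin.append_right y (fun _ => b) i
    rw [h₁, h₂]
    congr 1
    ext y z
    rw [Subsingleton.elim y default, Subsingleton.elim z default, Matrix.of_apply, h₃]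
    simp
  rw [probOne_nandCircuit]
  simp only [h, Fintype.sum_bool, stA.apply_eq_probOne, stS.apply_eq_probOne]
  have tA := stA.2
  have tS := stS.2
  rw [Matrix.trace, sum_bits_one] at tA tS
  simp only [Matrix.diag_apply, stA.apply_eq_probOne, stS.apply_eq_probOne] at tA tS
  rw [← eq_sub_iff_add_eq'] at tA tS
  rw [tA, tS]
  simp
  norm_cast
  ring

theorem IsAcceptProb.nand {a b : List Bool → ℝ} (ha : IsAcceptProb a) (hb : IsAcceptProb b) :
    IsAcceptProb fun x => 1 - a x * b x := by
  obtain ⟨A, hA, hA'⟩ := ha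
  obtain ⟨B, hB, hB'⟩ := hb
  -- Two independent runs are a degenerate interaction: the first bit is the private register, and
  -- the second is the answer to a message of zero qubits.
  have := isAcceptProb_interact (p := fun _ => 0) (r := fun _ => 1) (k := fun _ => 1) (A := A)
    (S := B) (B := fun _ => nandCircuit) (.const 0) (.const 1) (.const 1) hA hB
    ⟨.const _, fun _ => valid_nandCircuit⟩
  convert this using 2 with x
  rw [probOne_nandCircuit_interact (hA.2 x) (hB.2 x), hA', hB']

/-! ### Constant acceptance probabilities. -/

theorem probOne_single_gate (g : Gate) :
    probOne (QCircuit.channel ⟨1, [g]⟩ 0 1 1) =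
      Complex.normSq (g.op 1 (fun _ => true) (fun _ => false)) := by
  have hanc : ∀ u v : Bool, addAncillas 1 (1 : Op 0) (fun _ => u) (fun _ => v) =
      if u = false ∧ v = false then 1 else 0 := by
    intro u v
    rw [addAncillas, Matrix.of_apply, Subsingleton.elim (α := Bits 0) (fun i => wire _ i) default,
      Subsingleton.elim (α := Bits 0) (fun i => wire _ i) default, Matrix.one_apply_eq]
    exact if_congr (by simp) rfl rfl
  rw [probOne, QCircuit.channel, QCircuit.unitary_eq, circuitOp_singleton,
    keepFirst_eq_reduceOp le_rfl, show Fin.castLE le_rfl = fun _ : Fin 1 => (0 : Fin 1) by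
      ext i; simp, reduceOp_const_apply, sum_bits_one]
  simp [Matrix.mul_apply, sum_bits_one, hanc, Complex.normSq_apply]

theorem isAcceptProb_one : IsAcceptProb fun _ => 1 := by
  refine ⟨fun _ => ⟨1, [.not 0]⟩, ⟨.const _, fun _ => ?_⟩, fun _ => ?_⟩
  · simp [QCircuit.Valid, Gate.Valid]
  · rw [probOne_single_gate, Gate.op, Matrix.of_apply, if_pos (by decide), map_one]

theorem isAcceptProb_half : IsAcceptProb fun _ => 1 / 2 := by
  refine ⟨fun _ => ⟨1, [.had 0]⟩, ⟨.const _, fun _ => ?_⟩, fun _ => ?_⟩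
  · simp [QCircuit.Valid, Gate.Valid]
  · rw [probOne_single_gate, Gate.op, Matrix.of_apply, if_pos (by decide)]
    simp [wire]

theorem isAcceptProb_half_pow (n : ℕ) : IsAcceptProb fun _ => (1 / 2) ^ n := by
  induction n with
  | zero => simpa using isAcceptProb_one
  | succ n ih =>
    -- A NAND with the constant 1 is complementation, so two NANDs give a product.
    convert isAcceptProb_one.nand (ih.nand isAcceptProb_half) using 2
    ring

theorem isAcceptProb_zero : IsAcceptProb fun _ => 0 := by
  simpa using isAcceptProb_one.nand isAcceptProb_one

/-! ### Hard-wired inputs and closing the gap. -/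

theorem IsAcceptProb.update {a : List Bool → ℝ} (ha : IsAcceptProb a) {v : ℝ}
    (hv : IsAcceptProb fun _ => v) (x₀ : List Bool) :
    IsAcceptProb (Function.update a x₀ v) := by
  obtain ⟨C, ⟨hC, hC'⟩, hCa⟩ := ha
  obtain ⟨D, ⟨-, hD'⟩, hDv⟩ := hv
  refine ⟨Function.update C x₀ (D x₀), ⟨?_, fun x => ?_⟩, fun x => ?_⟩
  · convert hC.update x₀ (D x₀).encode using 1
    ext1 x
    by_cases h : x = x₀
    · subst h; simp
    · simp [h]
  · by_cases h : x = x₀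
    · subst h; simpa using hD' x
    · simpa [h] using hC' x
  · by_cases h : x = x₀
    · subst h; simpa using hDv x
    · simpa [h] using hCa x

open Classical in
-- Finitely many answers can be stored in the program that prints the circuits, whether or not `L`
-- is decidable.
theorem IsAcceptProb.ite_mem {a : List Bool → ℝ} (ha : IsAcceptProb a) (L : Language Bool)
    {s : Set (List Bool)} (hs : s.Finite) :
    IsAcceptProb fun x => if x ∈ s then (if x ∈ L then 1 else 0) else a x := by
  induction s, hs using Set.Finite.induction_on with
  | empty => simpa using ha
  | @insert x₀ s _ _ ih =>
    have hv : IsAcceptProb fun _ => if x₀ ∈ L then 1 else 0 := by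
      split_ifs
      · exact isAcceptProb_one
      · exact isAcceptProb_zero
    convert ih.update hv x₀ using 1
    ext x
    by_cases h : x = x₀
    · subst h; simp
    · simp [h]

/-- A constant gap around `2/3` and `1/3` that is closed up to a vanishing error suffices. -/
theorem mem_BQP_of_isAcceptProb {L : Language Bool} {a : List Bool → ℝ} (ha : IsAcceptProb a)
    {μ : ℕ → ℝ} (hμ : Filter.Tendsto μ Filter.atTop (nhds 0)) {ε : ℝ} (hε : ε < 1 / 3)
    (hL : ∀ x ∈ L, 2 / 3 - μ x.length ≤ a x) (hL' : ∀ x ∉ L, a x ≤ ε) : L ∈ BQP := by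
  classical
  -- The bias `η = 2⁻ⁿ` is chosen such that `ε + η (1 - ε) < 1/3`, so adding the coin keeps
  -- no-instances below `1/3`.
  obtain ⟨n, hn⟩ : ∃ n : ℕ, (1 / 2 : ℝ) ^ n < (1 / 3 - ε) / (1 - ε) :=
    exists_pow_lt_of_lt_one (div_pos (by linarith) (by linarith)) (by norm_num)
  rw [lt_div_iff₀ (by linarith)] at hn
  set η : ℝ := (1 / 2) ^ n with hη
  have hη₀ : 0 < η := by positivity
  have hη₁ : η ≤ 1 := pow_le_one₀ (by norm_num) (by norm_num)
  -- At acceptance probability `2/3 - μ` the coin adds `η (1/3 + μ)`, and `μ < η / 3` is enough to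
  -- get back to `2/3`. Inputs shorter than `N` go into the table.
  obtain ⟨N, hN⟩ := Filter.eventually_atTop.1
    (hμ.eventually_lt_const (show (0 : ℝ) < η / 3 by positivity))
  -- By De Morgan the NAND of the two complements is a disjunction, with probability `1 - (1 - a x)
  -- (1 - η)`.
  have hb := (((isAcceptProb_one.nand ha).nand
    (isAcceptProb_one.nand (isAcceptProb_half_pow n)))).ite_mem L (List.finite_length_lt Bool N)
  obtain ⟨C, hC, hCb⟩ := hb
  refine ⟨C, hC, fun x hx => ?_, fun x hx => ?_⟩
  · rw [hCb]
    beta_reduce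
    split_ifs with hxN
    · norm_num
    · have h₁ := hL x hx
      have h₂ := hN x.length (by simpa using hxN)
      rw [← hη]
      nlinarith
  · rw [hCb]
    beta_reduce
    split_ifs with hxN
    · norm_num
    · have h₁ := hL' x hx
      rw [← hη]
      nlinarith

/-! ### The verifier that forwards its auxiliary register -/

/-- The verifier who sends the auxiliary register to the prover and outputs the answer. -/
def forwardingVerifier (p r : List Bool → ℕ) : VerifierStrategy p p r r where
  priv := fun _ => 0
  first := fun x => ⟨p x, []⟩
  second := fun x => ⟨r x, []⟩

theorem channel_nil (n : ℕ) (ρ : Op n) : QCircuit.channel ⟨n, []⟩ n n ρ = ρ := by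
  rw [QCircuit.channel, QCircuit.unitary_eq, circuitOp_nil]
  simp [keepFirst_addAncillas]

theorem forwardingVerifier_interact (p r : List Bool → ℕ) (x : List Bool)
    (P : Op (p x) → Op (r x)) (ρ : Op (p x)) :
    (forwardingVerifier p r).interact x P ρ = P ρ := by
  refine (channel_nil (r x) _).trans ?_
  refine (joinOp_tensorId_zero_splitOp P _).trans ?_
  exact congrArg P (channel_nil (p x) ρ)

theorem forwardingVerifier_isQPT {p r : List Bool → ℕ} (hp : PolyTimeLength p)
    (hr : PolyTimeLength r) : (forwardingVerifier p r).IsQPT where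
  aux_length := hp
  output_length := hr
  priv_length := .const 0
  first_qpt := ⟨by simpa [QCircuit.encode, forwardingVerifier] using hp.encodeNat,
    fun x => by simp [QCircuit.Valid, forwardingVerifier]⟩
  second_qpt := ⟨by simpa [QCircuit.encode, forwardingVerifier] using hr.encodeNat,
    fun x => by simp [QCircuit.Valid, forwardingVerifier]⟩

/-! ### The simulator as an efficient prover. -/

theorem mainTheorem10 (L : Language Bool) (Pi : TwoMessageProtocol) (ε : ℝ) (hε : ε < 1 / 3)
    (hcorrect : Pi.Correct L (2 / 3)) (hsound : Pi.CompSound L ε)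
    (hzk : Pi.CompZeroKnowledge L) : L ∈ BQP := by
  obtain ⟨S, hS, hind⟩ := hzk _ _ (forwardingVerifier Pi.msg Pi.ans)
    (forwardingVerifier_isQPT Pi.msg_length Pi.ans_length)
  have hV := Pi.verifier_qpt
  obtain ⟨q₁, hq₁⟩ := hV.priv_length.length_le
  obtain ⟨q₂, hq₂⟩ := hV.second_qpt.1.length_le
  -- `q₁` bounds the private register, which plays the role of the `k` further qubits, and `q₂`
  -- bounds the distinguisher, which is the verifier's second circuit.
  obtain ⟨μ, hμ, hdist⟩ := hind (q₁ + q₂)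
  refine mem_BQP_of_isAcceptProb (a := fun x =>
    Pi.acceptProb x ((S x).channel (Pi.msg x) (Pi.ans x))) (μ := μ) ?_ ?_ hε ?_ ?_
  · exact isAcceptProb_interact Pi.msg_length Pi.ans_length hV.priv_length hV.first_qpt hS
      hV.second_qpt
  -- Of negligibility only convergence to zero is used, that is, the exponent 0.
  · simpa using hμ 0
  · intro x hx
    -- The distinguishing experiment on this state is the honest verifier's interaction, with the
    -- honest prover on one side and with `S` on the other.
    have h := hdist x hx (Pi.verifier.priv x) ?_ (Pi.verifier.second x) (hV.second_qpt.2 x) ?_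
      (splitOp ((Pi.verifier.first x).channel 0 (Pi.msg x + Pi.verifier.priv x) 1))
      (isState_one.channel (hV.first_qpt.2 x)).splitOp
    · have hc := hcorrect x hx
      beta_reduce at h
      rw [show (forwardingVerifier Pi.msg Pi.ans).interact x (Pi.prover x) = Pi.prover x from
        funext fun ρ => forwardingVerifier_interact _ _ _ _ ρ] at h
      have h' := (abs_le.1 h).2
      simp only [TwoMessageProtocol.acceptProb, VerifierStrategy.interact] at hc ⊢
      linarith
    · have := hq₁ x
      simp only [List.length_replicate] at this
      rw [Polynomial.eval_add]
      omega
    · have := hq₂ x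
      have := (Pi.verifier.second x).size_le_length_encode
      rw [Polynomial.eval_add]
      omega
  · exact fun x hx => hsound S hS x hx
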